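/- Let $\Gamma$ be a group. For a central element $g\in\Gamma$ of infinite order let $e_g\in H^2(\Gamma/\langle g\rangle;\mathbb Q)$ denote the (rational) Euler class of the central extension $1\to\mathbb Z\xrightarrow{\,g\,}\Gamma\to\Gamma/\langle g\rangle\to1$, and let $\rho_g\colon \mathrm B(\Gamma/\langle g\rangle)\to \mathrm B^2\mathbb Z=K(\mathbb Z,2)$ be the map classifying this extension. Suppose that 1. (central Burghelea property) for every central $g\in\Gamma$ of infinite order and every $n\ge 0$ the inverse limit of $$\cdots\xrightarrow{-\cap e_g}H_{n+4}(\Gamma/\langle g\rangle;\mathbb Q)\xrightarrow{-\cap e_g}H_{n+2}(\Gamma/\langle g\rangle;\mathbb Q)\xrightarrow{-\cap e_g}H_{n}(\Gamma/\langle g\rangle;\mathbb Q)$$ vanishes; 2. $\Gamma$ has finite rational cohomological dimension, $\mathrm{cd}_{\mathbb Q}(\Gamma)<\infty$; 3. the rational homology of $\Gamma$ is of finite type, i.e. $\dim_{\mathbb Q}H_n(\Gamma;\mathbb Q)<\infty$ for every $n$. Then $\Gamma$ has the individual kernel property $\mathcal{IKP}$: $\mathrm{cd}_{\mathbb Q}(\Gamma)<\infty$,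 and for every central $g\in\Gamma$ of infinite order the map $\rho_g^*\colon H^*(\mathrm B^2\mathbb Z;\mathbb Q)\to H^*(\mathrm B(\Gamma/\langle g\rangle);\mathbb Q)$ is not injective. Moreover, for every such $g$ the Euler class $e_g$ is nilpotent in the cohomology ring $H^*(\Gamma/\langle g\rangle;\mathbb Q)$. -/

import Mathlib

noncomputable section

open CategoryTheory Opposite
open scoped Simplicial

namespace CentralBurghelea

/-- A normalised inhomogeneous `2`-cocycle of the group `G` with values in `ℤ` (trivial action). -/
structure TwoCocycle (G : Type) [Group G] where
  toFun : G → G → ℤ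
  cocycle : ∀ x y z : G, toFun y z - toFun (x * y) z + toFun x (y * z) - toFun x y = 0
  one_left : ∀ x : G, toFun 1 x = 0
  one_right : ∀ x : G, toFun x 1 = 0

section

variable {G : Type} [Group G] (c : TwoCocycle G)

/-- The alternating sum of the bar faces of `x`, evaluated by `f`. For `f = single` this is the boundary
of the inhomogeneous chain `[x]`, for a cochain `f` it is the coboundary of `f` at `x`. -/
def barD {M : Type} [AddCommGroup M] [Module ℚ M] (n : ℕ) (f : (Fin n → G) → M)
    (x : Fin (n + 1) → G) : M :=
  f (fun i => x i.succ) +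
    ∑ j : Fin (n + 1), (-1 : ℚ) ^ ((j : ℕ) + 1) • f (Fin.contractNth j (· * ·) x)

/-- The value of the cocycle on the last two entries of `x`. -/
def weight {n : ℕ} (x : Fin (n + 2) → G) : ℚ :=
  (c.toFun (x (Fin.last n).castSucc) (x (Fin.last (n + 1))) : ℚ)

/-- All entries of `x` except the last two. -/
def front {n : ℕ} (x : Fin (n + 2) → G) : Fin n → G := fun i => x i.castSucc.castSucc

theorem barD_weight {M : Type} [AddCommGroup M] [Module ℚ M] (n : ℕ) (f : (Fin n → G) → M)
    (x : Fin (n + 3) → G) :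
    barD (n + 2) (fun y => weight c y • f (front y)) x = weight c x • barD n f (front x) := by
  have hf : ∀ j : Fin n, front (Fin.contractNth j.castSucc.castSucc.castSucc (· * ·) x) =
      Fin.contractNth j.castSucc (· * ·) (front x) := by
    intro j
    funext k
    simp [front, Fin.contractNth]
  have hw : ∀ j : Fin n, weight c (Fin.contractNth j.castSucc.castSucc.castSucc (· * ·) x) =
      weight c x := by
    intro j
    have h1 : ¬ (n < (j : ℕ)) := by omega
    have h2 : ¬ (n = (j : ℕ)) := by omega
    have h3 : ¬ (n + 1 < (j : ℕ)) := by omega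
    have h4 : ¬ (n + 1 = (j : ℕ)) := by omega
    simp [weight, Fin.contractNth, h1, h2, h3, h4]
    rfl
  have e1 : front (Fin.contractNth (Fin.last n).castSucc.castSucc (· * ·) x) =
      Fin.contractNth (Fin.last n) (· * ·) (front x) := by
    funext k
    simp [front, Fin.contractNth]
  have e2 : front (Fin.contractNth (Fin.last (n + 1)).castSucc (· * ·) x) =
      Fin.contractNth (Fin.last n) (· * ·) (front x) := by
    funext k
    have : (k : ℕ) < n + 1 := by omega
    simp [front, Fin.contractNth, this]
  have e3 : front (Fin.contractNth (Fin.last (n + 2)) (· * ·) x) =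
      Fin.contractNth (Fin.last n) (· * ·) (front x) := by
    funext k
    have : (k : ℕ) < n + 2 := by omega
    simp [front, Fin.contractNth, this]
  have w0 : weight c (fun i => x i.succ) = weight c x := by
    simp [weight, ← Fin.castSucc_succ]
  have w1 : weight c (Fin.contractNth (Fin.last n).castSucc.castSucc (· * ·) x) =
      c.toFun (x (Fin.last n).castSucc.castSucc * x (Fin.last (n + 1)).castSucc)
        (x (Fin.last (n + 2))) := by
    simp [weight, Fin.contractNth]
    rfl
  have w2 : weight c (Fin.contractNth (Fin.last (n + 1)).castSucc (· * ·) x) =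
      c.toFun (x (Fin.last n).castSucc.castSucc) (x (Fin.last (n + 1)).castSucc *
        (x (Fin.last (n + 2)))) := by
    simp [weight, Fin.contractNth]
  have w3 : weight c (Fin.contractNth (Fin.last (n + 2)) (· * ·) x) =
      c.toFun (x (Fin.last n).castSucc.castSucc) (x (Fin.last (n + 1)).castSucc) := by
    simp [weight, Fin.contractNth]
  have hc : weight c x = c.toFun (x (Fin.last n).castSucc.castSucc *
      x (Fin.last (n + 1)).castSucc) (x (Fin.last (n + 2))) -
      c.toFun (x (Fin.last n).castSucc.castSucc) (x (Fin.last (n + 1)).castSucc *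
        (x (Fin.last (n + 2)))) +
      c.toFun (x (Fin.last n).castSucc.castSucc) (x (Fin.last (n + 1)).castSucc) := by
    have := c.cocycle (x (Fin.last n).castSucc.castSucc) (x (Fin.last (n + 1)).castSucc)
      (x (Fin.last (n + 2)))
    simp only [weight]
    exact_mod_cast (by linarith)
  unfold barD
  rw [Fin.sum_univ_castSucc, Fin.sum_univ_castSucc, Fin.sum_univ_castSucc,
    Fin.sum_univ_castSucc (n := n)]
  simp only [hf, hw, e1, e2, e3, w0, w1, w2, w3, Fin.val_castSucc, Fin.val_last, smul_add,
    Finset.smul_sum]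
  have : front (fun i => x i.succ) = fun i => front x i.succ := rfl
  rw [this, add_assoc, add_assoc]
  congr 2
  · exact Finset.sum_congr rfl fun j _ => smul_comm _ _ _
  · simp only [smul_smul, ← add_smul]
    congr 1
    rw [hc]
    ring


/-- Inhomogeneous (bar) chains of `G` with trivial rational coefficients. -/
abbrev chains (G : Type) [Group G] : ChainComplex (ModuleCat ℚ) ℕ :=
  groupHomology.inhomogeneousChains (Rep.trivial ℚ G ℚ)

/-- Cap product with the cocycle on bar chains:
`[x₁|…|xₙ₊₂] ↦ c(xₙ₊₁, xₙ₊₂) [x₁|…|xₙ]`. -/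
def capChains (n : ℕ) : (chains G).X (n + 2) ⟶ (chains G).X n :=
  ModuleCat.ofHom (Finsupp.lsum ℚ fun x : Fin (n + 2) → G =>
    weight c x • (Finsupp.lsingle (front x) : ℚ →ₗ[ℚ] ((Fin n → G) →₀ ℚ)))

theorem capChains_single (n : ℕ) (x : Fin (n + 2) → G) (a : ℚ) :
    (capChains c n).hom (Finsupp.single x a : (Fin (n + 2) → G) →₀ ℚ) =
      weight c x • (Finsupp.single (front x) a : (Fin n → G) →₀ ℚ) :=
  (Finsupp.lsum_single (S := ℚ) _ x a).trans rfl

theorem boundary_single (n : ℕ) (x : Fin (n + 1) → G) :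
    ((chains G).d (n + 1) n).hom (Finsupp.single x (1 : ℚ) : (Fin (n + 1) → G) →₀ ℚ) =
      barD n (fun y => (Finsupp.single y (1 : ℚ) : (Fin n → G) →₀ ℚ)) x := by
  rw [groupHomology.inhomogeneousChains.d_def]
  exact groupHomology.inhomogeneousChains.d_single (A := Rep.trivial ℚ G ℚ) n x 1

theorem capChains_comp_d (n : ℕ) :
    capChains c (n + 1) ≫ (chains G).d (n + 1) n =
      (chains G).d (n + 3) (n + 2) ≫ capChains c n := by
  apply ModuleCat.hom_ext
  refine Finsupp.lhom_ext' fun x => LinearMap.ext_ring ?_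
  change ((chains G).d (n + 1) n).hom ((capChains c (n + 1)).hom
      (Finsupp.single x (1 : ℚ) : (Fin (n + 3) → G) →₀ ℚ)) =
    (capChains c n).hom (((chains G).d (n + 3) (n + 2)).hom
      (Finsupp.single x (1 : ℚ) : (Fin (n + 3) → G) →₀ ℚ))
  rw [boundary_single, capChains_single]
  refine ((((chains G).d (n + 1) n).hom.map_smul _ _).trans ?_)
  rw [boundary_single, ← barD_weight]
  simp only [barD]
  refine Eq.symm (((capChains c n).hom.map_add _ _).trans ?_)
  rw [capChains_single]
  congr 1
  refine (map_sum (capChains c n).hom _ _).trans (Finset.sum_congr rfl fun j _ => ?_)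
  refine ((capChains c n).hom.map_smul _ _).trans ?_
  rw [capChains_single]

theorem capChains_comp_d_eq_zero (n : ℕ) :
    ((chains G).iCycles (n + 2) ≫ capChains c n) ≫
      (chains G).d n ((ComplexShape.down ℕ).next n) = 0 := by
  cases n with
  | zero => rw [ChainComplex.next_nat_zero, (chains G).shape 0 0 (by simp), Limits.comp_zero]
  | succ n =>
    rw [ChainComplex.next_nat_succ, Category.assoc, capChains_comp_d,
      HomologicalComplex.iCycles_d_assoc, Limits.zero_comp]

/-- Cap product with the cocycle on cycles. -/
def capCycles (n : ℕ) : (chains G).cycles (n + 2) ⟶ (chains G).cycles n :=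
  (chains G).liftCycles ((chains G).iCycles (n + 2) ≫ capChains c n) _ rfl
    (capChains_comp_d_eq_zero c n)

theorem toCycles_capCycles (n : ℕ) :
    (chains G).toCycles (n + 3) (n + 2) ≫ capCycles c n ≫ (chains G).homologyπ n = 0 := by
  have h : (chains G).toCycles (n + 3) (n + 2) ≫ capCycles c n =
      capChains c (n + 1) ≫ (chains G).toCycles (n + 1) n := by
    rw [← cancel_mono ((chains G).iCycles n)]
    simp only [capCycles, Category.assoc, HomologicalComplex.liftCycles_i,
      HomologicalComplex.toCycles_i, HomologicalComplex.toCycles_i_assoc]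
    exact (capChains_comp_d c n).symm
  rw [← Category.assoc, h, Category.assoc, HomologicalComplex.toCycles_comp_homologyπ,
    Limits.comp_zero]

/-- Cap product `H_{n+2}(G; ℚ) ⟶ H_n(G; ℚ)` with the class of the cocycle. -/
def capHomology (n : ℕ) :
    groupHomology (Rep.trivial ℚ G ℚ) (n + 2) ⟶ groupHomology (Rep.trivial ℚ G ℚ) n :=
  ((chains G).homologyIsCokernel (n + 3) (n + 2) (ChainComplex.prev ℕ (n + 2))).desc
    (Limits.CokernelCofork.ofπ (capCycles c n ≫ (chains G).homologyπ n)
      (toCycles_capCycles c n))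

theorem π_capHomology (n : ℕ) :
    groupHomology.π (Rep.trivial ℚ G ℚ) (n + 2) ≫ capHomology c n =
      capCycles c n ≫ groupHomology.π (Rep.trivial ℚ G ℚ) n :=
  Limits.Cofork.IsColimit.π_desc
    ((chains G).homologyIsCokernel (n + 3) (n + 2) (ChainComplex.prev ℕ (n + 2)))

/-- The cup product of inhomogeneous cochains with trivial rational coefficients. -/
def cup {p q : ℕ} (f : (Fin p → G) → ℚ) (h : (Fin q → G) → ℚ) : (Fin (p + q) → G) → ℚ :=
  fun x => f (fun i => x (Fin.castAdd q i)) * h (fun i => x (Fin.natAdd p i))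

/-- The rational bar cochain underlying an integral `2`-cocycle. -/
def TwoCocycle.toCochain : (Fin 2 → G) → ℚ := fun x => (c.toFun (x 0) (x 1) : ℚ)

/-- The `m`-fold cup product of the cocycle with itself, a cochain of degree `2 * m`. -/
def cupPower (m : ℕ) : (Fin (2 * m) → G) → ℚ :=
  Nat.rec (motive := fun m => (Fin (2 * m) → G) → ℚ) (fun _ => 1)
    (fun _ f => cup f c.toCochain) m

theorem d_cupPower (m : ℕ) :
    inhomogeneousCochains.d (Rep.trivial ℚ G ℚ) (2 * m) (cupPower c m) = 0 := by
  induction m with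
  | zero =>
    funext x
    change barD 0 (fun _ => (1 : ℚ)) x = 0
    simp [barD]
  | succ m ih =>
    funext x
    have h := barD_weight c (2 * m) (cupPower c m) x
    have h0 : barD (2 * m) (cupPower c m) (front x) = 0 := congrFun ih (front x)
    rw [h0, smul_zero] at h
    rw [Pi.zero_apply, ← h]
    change barD (2 * m + 2) (fun y => cupPower c m (front y) * weight c y) x = _
    simp only [smul_eq_mul, mul_comm]

/-- The `m`-th power, in the cohomology ring of `G` with rational coefficients, of the class
of the cocycle. -/
def cohomologyPower (m : ℕ) : groupCohomology (Rep.trivial ℚ G ℚ) (2 * m) :=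
  groupCohomology.π (Rep.trivial ℚ G ℚ) (2 * m)
    (groupCohomology.cocyclesMk (cupPower c m) (d_cupPower c m))

end

/-- The Eilenberg-MacLane space `K(ℤ, 2) = B²ℤ`, in its standard simplicial model: its `n`-simplices
are the normalised simplicial `2`-cocycles on the standard `n`-simplex with values in `ℤ`. -/
def deloopingTwo : SSet.{0} where
  obj n := { z : (⦋2⦌ ⟶ n.unop) → ℤ //
    (∀ τ : ⦋3⦌ ⟶ n.unop, ∑ i : Fin 4, (-1 : ℤ) ^ (i : ℕ) * z (SimplexCategory.δ i ≫ τ) = 0) ∧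
    (∀ (ε : ⦋1⦌ ⟶ n.unop) (i : Fin 2), z (SimplexCategory.σ i ≫ ε) = 0) }
  map f := ↾fun z => ⟨fun τ => z.1 (τ ≫ f.unop),
    fun τ => by simpa only [Category.assoc] using z.2.1 (τ ≫ f.unop),
    fun ε i => by simpa only [Category.assoc] using z.2.2 (ε ≫ f.unop) i⟩

/-- The cosimplicial vector space `n ↦ Map(Xₙ, ℚ)` of a simplicial set `X`. -/
def cosimplicialCochains (X : SSet.{0}) : CosimplicialObject (ModuleCat.{0} ℚ) where
  obj n := ModuleCat.of ℚ (X.obj (op n) → ℚ)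
  map f := ModuleCat.ofHom (LinearMap.funLeft ℚ ℚ (X.map f.op))

/-- The rational simplicial cochain complex of a simplicial set, with differential the alternating
sum of the coface maps. Its homology in degree `n` is `Hⁿ(X; ℚ)`. -/
def simplicialCochains (X : SSet.{0}) : CochainComplex (ModuleCat.{0} ℚ) ℕ :=
  (AlgebraicTopology.alternatingCofaceMapComplex (ModuleCat.{0} ℚ)).obj (cosimplicialCochains X)

section
variable {G : Type} [Group G] (c : TwoCocycle G)

/-- The label of the edge from the `i`-th to the `j`-th vertex of the simplex `[x₁|…|xₙ]` of `BG`,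
that is `xᵢ₊₁ ⋯ xⱼ` when `i ≤ j`. -/
def edge {n : ℕ} (x : Fin n → G) (i j : Fin (n + 1)) : G :=
  (Fin.partialProd x i)⁻¹ * Fin.partialProd x j

theorem edge_self {n : ℕ} (x : Fin n → G) (i : Fin (n + 1)) : edge x i i = 1 :=
  inv_mul_cancel _

theorem edge_mul_edge {n : ℕ} (x : Fin n → G) (i j k : Fin (n + 1)) :
    edge x i j * edge x j k = edge x i k := by
  simp [edge, mul_assoc]

/-- The map `BG ⟶ K(ℤ, 2)` that classifies the cocycle, on the simplex `[x₁|…|xₙ]` of the bar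
construction: a triangle of it is sent to the value of the cocycle on its first and last edge. -/
def classifyingSimplex {n : ℕ} (x : Fin n → G) : deloopingTwo _⦋n⦌ :=
  ⟨fun τ : ⦋2⦌ ⟶ ⦋n⦌ =>
    c.toFun (edge x (τ.toOrderHom 0) (τ.toOrderHom 1)) (edge x (τ.toOrderHom 1) (τ.toOrderHom 2)),
    fun τ : ⦋3⦌ ⟶ ⦋n⦌ => by
      have h := c.cocycle (edge x (τ.toOrderHom 0) (τ.toOrderHom 1))
        (edge x (τ.toOrderHom 1) (τ.toOrderHom 2)) (edge x (τ.toOrderHom 2) (τ.toOrderHom 3))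
      rw [edge_mul_edge, edge_mul_edge] at h
      rw [Fin.sum_univ_four, ← h]
      change (-1 : ℤ) ^ 0 * c.toFun (edge x (τ.toOrderHom 1) (τ.toOrderHom 2))
          (edge x (τ.toOrderHom 2) (τ.toOrderHom 3)) +
        (-1 : ℤ) ^ 1 * c.toFun (edge x (τ.toOrderHom 0) (τ.toOrderHom 2))
          (edge x (τ.toOrderHom 2) (τ.toOrderHom 3)) +
        (-1 : ℤ) ^ 2 * c.toFun (edge x (τ.toOrderHom 0) (τ.toOrderHom 1))
          (edge x (τ.toOrderHom 1) (τ.toOrderHom 3)) +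
        (-1 : ℤ) ^ 3 * c.toFun (edge x (τ.toOrderHom 0) (τ.toOrderHom 1))
          (edge x (τ.toOrderHom 1) (τ.toOrderHom 2)) = _
      ring,
    fun (ε : ⦋1⦌ ⟶ ⦋n⦌) i => by
      fin_cases i
      · change c.toFun (edge x (ε.toOrderHom 0) (ε.toOrderHom 0)) _ = 0
        rw [edge_self, c.one_left]
      · change c.toFun _ (edge x (ε.toOrderHom 1) (ε.toOrderHom 1)) = 0
        rw [edge_self, c.one_right]⟩

theorem edge_tail {n : ℕ} (x : Fin (n + 1) → G) (i j : Fin (n + 1)) :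
    edge x i.succ j.succ = edge (fun k => x k.succ) i j := by
  simp only [edge, Fin.partialProd_succ', mul_inv_rev, mul_assoc, inv_mul_cancel_left]
  rfl

theorem edge_contractNth {n : ℕ} (x : Fin (n + 1) → G) (a : Fin (n + 1)) (i j : Fin (n + 1)) :
    edge x (a.succ.succAbove i) (a.succ.succAbove j) =
      edge (Fin.contractNth a (· * ·) x) i j := by
  simp only [edge, Fin.partialProd_contractNth, Function.comp]

theorem δ_zero_classifyingSimplex {n : ℕ} (x : Fin (n + 1) → G) :
    deloopingTwo.δ 0 (classifyingSimplex c x) = classifyingSimplex c (fun i => x i.succ) := by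
  apply Subtype.ext
  funext τ
  change c.toFun (edge x (Fin.succAbove 0 _) (Fin.succAbove 0 _))
    (edge x (Fin.succAbove 0 _) (Fin.succAbove 0 _)) = _
  simp only [Fin.zero_succAbove, edge_tail]
  rfl

theorem δ_succ_classifyingSimplex {n : ℕ} (x : Fin (n + 1) → G) (j : Fin (n + 1)) :
    deloopingTwo.δ j.succ (classifyingSimplex c x) =
      classifyingSimplex c (Fin.contractNth j (· * ·) x) := by
  apply Subtype.ext
  funext τ
  change c.toFun (edge x (j.succ.succAbove _) (j.succ.succAbove _))
    (edge x (j.succ.succAbove _) (j.succ.succAbove _)) = _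
  simp only [edge_contractNth]
  rfl

theorem alternating_sum_apply {V W : ModuleCat.{0} ℚ} {n : ℕ} (F : Fin n → (V ⟶ W)) (v : V) :
    (∑ i : Fin n, (-1 : ℤ) ^ (i : ℕ) • F i).hom v =
      ∑ i : Fin n, (-1 : ℚ) ^ (i : ℕ) • (F i).hom v := by
  rw [ModuleCat.hom_sum, LinearMap.sum_apply]
  refine Finset.sum_congr rfl fun i _ => ?_
  rw [ModuleCat.hom_zsmul, LinearMap.smul_apply, ← Int.cast_smul_eq_zsmul ℚ]
  simp

theorem simplicialCochains_d_apply (X : SSet.{0}) (n : ℕ) (f : X _⦋n⦌ → ℚ) (y : X _⦋n + 1⦌) :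
    (show X _⦋n + 1⦌ → ℚ from ((simplicialCochains X).d n (n + 1)).hom f) y =
      ∑ i : Fin (n + 2), (-1 : ℚ) ^ (i : ℕ) * f (X.δ i y) := by
  have h : (simplicialCochains X).d n (n + 1) =
      AlgebraicTopology.AlternatingCofaceMapComplex.objD (cosimplicialCochains X) n :=
    CochainComplex.of_d (fun n => (cosimplicialCochains X).obj ⦋n⦌)
      (AlgebraicTopology.AlternatingCofaceMapComplex.objD (cosimplicialCochains X)) n
  rw [h]
  refine (congrFun (alternating_sum_apply (fun i => (cosimplicialCochains X).δ i) f) y).trans ?_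
  exact Finset.sum_apply y _ _

/-- Pullback of cochains along the classifying map `BG ⟶ K(ℤ, 2)`; the cochains of `BG` are the
inhomogeneous cochains of `G`. -/
def classifyingCochains :
    simplicialCochains deloopingTwo ⟶
      groupCohomology.inhomogeneousCochains (Rep.trivial ℚ G ℚ) where
  f n := ModuleCat.ofHom (LinearMap.funLeft ℚ ℚ (classifyingSimplex c (n := n)))
  comm' i j hij := by
    obtain rfl : i + 1 = j := hij
    rw [groupCohomology.inhomogeneousCochains.d_def]
    apply ModuleCat.hom_ext
    refine LinearMap.ext fun (f : deloopingTwo _⦋i⦌ → ℚ) => funext fun x => ?_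
    change barD i (fun y => f (classifyingSimplex c y)) x =
      (show deloopingTwo _⦋i + 1⦌ → ℚ from
        ((simplicialCochains deloopingTwo).d i (i + 1)).hom f) (classifyingSimplex c x)
    rw [simplicialCochains_d_apply, Fin.sum_univ_succ]
    simp only [δ_zero_classifyingSimplex, δ_succ_classifyingSimplex, barD, Fin.val_zero, pow_zero,
      one_mul, Fin.val_succ, smul_eq_mul]

/-- The map `Hⁿ(B²ℤ; ℚ) ⟶ Hⁿ(BG; ℚ) = Hⁿ(G; ℚ)` induced by the classifying map of the cocycle. -/
def classifyingMap (n : ℕ) :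
    (simplicialCochains deloopingTwo).homology n ⟶ groupCohomology (Rep.trivial ℚ G ℚ) n :=
  HomologicalComplex.homologyMap (classifyingCochains c) n

end

/-- A central element of infinite order. -/
structure CentralElement (Γ : Type) [Group Γ] where
  val : Γ
  mem_center : val ∈ Subgroup.center Γ
  infinite_order : ¬ IsOfFinOrder val

section
variable {Γ : Type} [Group Γ] (g : CentralElement Γ)

theorem CentralElement.comm (x : Γ) (k : ℤ) : x * g.val ^ k = g.val ^ k * x :=
  (Commute.zpow_right (Subgroup.mem_center_iff.1 g.mem_center x) k)

instance CentralElement.normal : (Subgroup.zpowers g.val).Normal where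
  conj_mem := by
    rintro _ ⟨k, rfl⟩ x
    exact ⟨k, by simp only [g.comm, mul_inv_cancel_right]⟩

/-- The quotient `Γ/⟨g⟩`. -/
abbrev CentralElement.BaseGroup : Type := Γ ⧸ Subgroup.zpowers g.val

open Classical in
/-- A set-theoretic right inverse of `Γ → Γ/⟨g⟩` with `1 ↦ 1`. -/
def CentralElement.lift (q : g.BaseGroup) : Γ := if q = 1 then 1 else q.out

theorem CentralElement.mk_lift (q : g.BaseGroup) : (g.lift q : g.BaseGroup) = q := by
  unfold CentralElement.lift
  split_ifs with h
  · exact h.symm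
  · exact Quotient.out_eq' q

theorem CentralElement.exists_zpow (p q : g.BaseGroup) :
    ∃ k : ℤ, g.lift p * g.lift q = g.val ^ k * g.lift (p * q) := by
  have h : ((g.lift (p * q) : Γ) : g.BaseGroup) = ((g.lift p * g.lift q : Γ) : g.BaseGroup) := by
    rw [QuotientGroup.mk_mul, g.mk_lift, g.mk_lift, g.mk_lift]
  obtain ⟨k, hk⟩ := QuotientGroup.eq.1 h
  refine ⟨k, ?_⟩
  rw [← g.comm]
  exact (eq_mul_of_inv_mul_eq hk.symm)

/-- The integer `k` with `s(p) s(q) = g ^ k s(p q)`, where `s` is the chosen lift. -/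
def CentralElement.eulerFun (p q : g.BaseGroup) : ℤ := Classical.choose (g.exists_zpow p q)

theorem CentralElement.eulerFun_spec (p q : g.BaseGroup) :
    g.lift p * g.lift q = g.val ^ g.eulerFun p q * g.lift (p * q) :=
  Classical.choose_spec (g.exists_zpow p q)

theorem CentralElement.zpow_injective : Function.Injective fun k : ℤ => g.val ^ k :=
  injective_zpow_iff_not_isOfFinOrder.2 g.infinite_order

/-- The cocycle of the central extension `1 → ℤ → Γ → Γ/⟨g⟩ → 1` given by `g`; its class in
`H²(Γ/⟨g⟩; ℚ)` is the Euler class of the extension. -/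
def CentralElement.eulerCocycle : TwoCocycle g.BaseGroup where
  toFun := g.eulerFun
  cocycle x y z := by
    have h : g.val ^ (g.eulerFun x y + g.eulerFun (x * y) z) =
        g.val ^ (g.eulerFun y z + g.eulerFun x (y * z)) := by
      apply mul_right_cancel (b := g.lift (x * y * z))
      calc g.val ^ (g.eulerFun x y + g.eulerFun (x * y) z) * g.lift (x * y * z)
          = g.lift x * g.lift y * g.lift z := by
            rw [g.eulerFun_spec x y, mul_assoc (g.val ^ _) (g.lift _), g.eulerFun_spec (x * y) z,
              zpow_add, mul_assoc (g.val ^ _) (g.val ^ _)]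
        _ = g.val ^ (g.eulerFun y z + g.eulerFun x (y * z)) * g.lift (x * y * z) := by
            rw [mul_assoc, g.eulerFun_spec y z, ← mul_assoc, g.comm, mul_assoc,
              g.eulerFun_spec x (y * z), zpow_add, mul_assoc (g.val ^ _) (g.val ^ _), mul_assoc x y z]
    have := g.zpow_injective h
    omega
  one_left x := by
    apply g.zpow_injective
    have h := g.eulerFun_spec 1 x
    have h1 : g.lift 1 = 1 := if_pos rfl
    rw [h1, one_mul, one_mul] at h
    simpa using h.symm
  one_right x := by
    apply g.zpow_injective
    have h := g.eulerFun_spec x 1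
    have h1 : g.lift 1 = 1 := if_pos rfl
    rw [h1, mul_one, mul_one] at h
    simpa using h.symm

/-- The inverse limit of `… → H_{n+4}(Γ/⟨g⟩; ℚ) → H_{n+2}(Γ/⟨g⟩; ℚ) → H_n(Γ/⟨g⟩; ℚ)` along cap products
with the Euler class. As `g` is central, its centraliser is `Γ`. -/
def CentralElement.capLimit (n : ℕ) :
    Submodule ℚ (∀ k : ℕ, groupHomology (Rep.trivial ℚ g.BaseGroup ℚ) (n + 2 * k)) where
  carrier := { z | ∀ k : ℕ, (capHomology g.eulerCocycle (n + 2 * k)).hom (z (k + 1)) = z k }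
  add_mem' := fun {a b} ha hb k => by
    exact (map_add _ _ _).trans (congrArg₂ _ (ha k) (hb k))
  zero_mem' := fun k => map_zero _
  smul_mem' := fun r z hz k => ((map_smul _ r _).trans (congrArg _ (hz k)))

end

/-- Finite rational cohomological dimension. -/
def HasFiniteRationalCD (Γ : Type) [Group Γ] : Prop :=
  ∃ d : ℕ, ∀ (A : Rep.{0} ℚ Γ) (n : ℕ), d < n → Limits.IsZero (groupCohomology A n)

/-- Every rational homology group of `Γ` is finite-dimensional. -/
def HasFiniteTypeRationalHomology (Γ : Type) [Group Γ] : Prop :=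
  ∀ n : ℕ, Module.Finite ℚ (groupHomology (Rep.trivial ℚ Γ ℚ) n)

/-- The central Burghelea property. -/
def CBP (Γ : Type) [Group Γ] : Prop :=
  ∀ (g : CentralElement Γ) (n : ℕ), g.capLimit n = ⊥

/-- The individual kernel property: finite rational cohomological dimension, and for each central `g`
of infinite order the map `H^*(B²ℤ; ℚ) ⟶ H^*(B(Γ/⟨g⟩); ℚ)` that is induced by the classifying map of
the extension is not injective (a graded map: not injective in some degree). -/
def IKP (Γ : Type) [Group Γ] : Prop :=
  HasFiniteRationalCD Γ ∧ ∀ g : CentralElement Γ, ∃ n : ℕ,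
    ¬ Function.Injective (classifyingMap g.eulerCocycle n)

end CentralBurghelea

end

/-!
Write `Q = Γ/⟨g⟩` and let `e` be the Euler class. By the Gysin sequence of the extension, capping
with `e` maps `H_{n+2}(Q; ℚ)` onto `H_n(Q; ℚ)` as soon as `n` is at least the rational cohomological
dimension of `Γ`. This is made explicit as follows: the bar boundary of `Q` with coefficients in
`ℚ[Γ]`, twisted by a set-theoretic lift `Q → Γ`, satisfies `∂² = (g - 1)h`, where `h` becomes the
cap product with `e` over `ℚ`. Hence `∂`, `g - 1` and `-h` are the entries of the differential of a
mapping cone, which is a free resolution of `ℚ` over `ℚ[Γ]`, and two copies of the bar cochains of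
`Q` that are coupled by `e` compute the cohomology of `Γ`. An inverse sequence of surjections whose
limit vanishes consists of zero spaces, so `H_n(Q; ℚ)` vanishes in high degrees. Over `ℚ` cohomology
is dual to homology, hence the high powers of `e` vanish.

The classifying map sends the powers of the fundamental class of `K(ℤ, 2)` to the powers of `e`, so
that it has a kernel as soon as the former are nonzero. A power of the fundamental class is detected
on a free abelian group of even rank: on the antisymmetrization of the tuple of its generators, all
coboundaries vanish but the power of the standard degree two class does not.
-/

noncomputable section

open CategoryTheory

namespace CentralBurghelea

theorem front_snoc {G : Type} {n : ℕ} (x : Fin (n + 1) → G) (q : G) :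
    front (Fin.snoc x q : Fin (n + 2) → G) = Fin.init x := by
  funext i
  simp [Fin.init, front]

section BarCoboundary

variable {G M N : Type} [Group G] [AddCommGroup M] [Module ℚ M] [AddCommGroup N] [Module ℚ N]

theorem barD_add (n : ℕ) (f h : (Fin n → G) → M) : barD n (f + h) = barD n f + barD n h := by
  funext x
  simp only [barD, Pi.add_apply, smul_add, Finset.sum_add_distrib]
  abel

theorem barD_smul (n : ℕ) (r : ℚ) (f : (Fin n → G) → M) : barD n (r • f) = r • barD n f := by
  funext x
  simp only [barD, Pi.smul_apply, smul_add, Finset.smul_sum, smul_comm r]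

theorem barD_sub (n : ℕ) (f h : (Fin n → G) → M) : barD n (f - h) = barD n f - barD n h := by
  rw [sub_eq_add_neg, sub_eq_add_neg, ← neg_one_smul ℚ h, barD_add, barD_smul, neg_one_smul]

theorem map_barD {F : Type} [FunLike F M N] [LinearMapClass F ℚ M N] (φ : F) (n : ℕ)
    (f : (Fin n → G) → M) (x : Fin (n + 1) → G) : φ (barD n f x) = barD n (φ ∘ f) x := by
  simp only [barD, map_add, map_sum, map_smul, Function.comp_apply]

theorem barD_barD (n : ℕ) (f : (Fin n → G) → M) : barD (n + 1) (barD n f) = 0 :=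
  congrArg (fun φ => φ.hom f) <|
    groupCohomology.inhomogeneousCochains.d_comp_d n (Rep.trivial ℚ G M)

theorem contractNth_last {n : ℕ} (x : Fin (n + 1) → G) :
    Fin.contractNth (Fin.last n) (· * ·) x = Fin.init x := by
  funext i
  simp [Fin.init, Fin.contractNth]

theorem contractNth_castSucc_castSucc_snoc {n : ℕ} (j : Fin n) (x : Fin (n + 1) → G) (q : G) :
    Fin.contractNth j.castSucc.castSucc (· * ·) (Fin.snoc x q : Fin (n + 2) → G) =
      (Fin.snoc (Fin.contractNth j.castSucc (· * ·) x) q : Fin (n + 1) → G) := by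
  funext i
  refine Fin.lastCases ?_ (fun i => ?_) i
  · have : ¬ n < (j : ℕ) ∧ n ≠ j := by omega
    simp [Fin.contractNth, this]
  · simp only [Fin.contractNth, Fin.snoc_castSucc, Fin.val_castSucc, ← Fin.castSucc_succ]

theorem contractNth_castSucc_last_snoc {n : ℕ} (x : Fin (n + 1) → G) (q : G) :
    Fin.contractNth (Fin.last n).castSucc (· * ·) (Fin.snoc x q : Fin (n + 2) → G) =
      (Fin.snoc (Fin.init x) (x (Fin.last n) * q) : Fin (n + 1) → G) := by
  funext i
  refine Fin.lastCases ?_ (fun i => ?_) i <;> simp [Fin.init, Fin.contractNth]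

theorem barD_snoc (n : ℕ) (f : (Fin (n + 1) → G) → M) (x : Fin (n + 1) → G) (q : G) :
    barD (n + 1) f (Fin.snoc x q : Fin (n + 2) → G) =
      barD n (fun y => f (Fin.snoc y q : Fin (n + 1) → G)) x +
        (-1 : ℚ) ^ (n + 1) • (f (Fin.snoc (Fin.init x) (x (Fin.last n) * q) : Fin (n + 1) → G) -
          f (Fin.snoc (Fin.init x) q : Fin (n + 1) → G)) + (-1 : ℚ) ^ (n + 2) • f x := by
  have htail : (fun i => (Fin.snoc x q : Fin (n + 2) → G) i.succ) =
      (Fin.snoc (fun i => x i.succ) q : Fin (n + 1) → G) := by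
    funext i
    refine Fin.lastCases ?_ (fun i => ?_) i <;> simp [← Fin.castSucc_succ]
  unfold barD
  rw [Fin.sum_univ_castSucc, Fin.sum_univ_castSucc, Fin.sum_univ_castSucc (n := n)]
  simp only [htail, contractNth_castSucc_castSucc_snoc, contractNth_castSucc_last_snoc,
    contractNth_last, Fin.init_snoc, Fin.val_castSucc, Fin.val_last]
  rw [smul_sub]
  abel

end BarCoboundary

section TwistedCoboundary

open Representation

variable {G Γ V W : Type} [Group G] [Group Γ] [AddCommGroup V] [Module ℚ V]
  [AddCommGroup W] [Module ℚ W]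

/-- The bar coboundary of a family of vectors of a representation `ρ` of `Γ` indexed by tuples in
another group `G`: the last face is twisted by the inverse of `s`, which is a set-theoretic lift
`G → Γ` in the applications. The square of this operator measures how far `s` is from being
multiplicative. -/
def twistedD (ρ : Representation ℚ Γ V) (s : G → Γ) (n : ℕ) (f : (Fin n → G) → V)
    (x : Fin (n + 1) → G) : V :=
  barD n f x +
    (-1 : ℚ) ^ (n + 1) • (ρ (s (x (Fin.last n)))⁻¹ (f (Fin.init x)) - f (Fin.init x))

theorem map_twistedD {ρ : Representation ℚ Γ V} {σ : Representation ℚ Γ W}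
    (φ : IntertwiningMap ρ σ) (s : G → Γ) (n : ℕ) (f : (Fin n → G) → V) (x : Fin (n + 1) → G) :
    φ (twistedD ρ s n f x) = twistedD σ s n (φ ∘ f) x := by
  simp only [twistedD, map_add, map_barD, map_smul, map_sub, φ.isIntertwining, Function.comp_apply]

theorem twistedD_trivial (s : G → Γ) (n : ℕ) (f : (Fin n → G) → V) :
    twistedD (trivial ℚ Γ V) s n f = barD n f := by
  funext x
  simp [twistedD]

theorem twistedD_twistedD (ρ : Representation ℚ Γ V) (s : G → Γ) (n : ℕ) (f : (Fin n → G) → V)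
    (x : Fin (n + 2) → G) :
    twistedD ρ s (n + 1) (twistedD ρ s n f) x =
      ρ (s (x (Fin.last n).castSucc * x (Fin.last (n + 1))))⁻¹ (f (front x)) -
        ρ (s (x (Fin.last n).castSucc) * s (x (Fin.last (n + 1))))⁻¹ (f (front x)) := by
  obtain ⟨x, q, rfl⟩ : ∃ (y : Fin (n + 1) → G) (q : G), x = (Fin.snoc y q : Fin (n + 2) → G) :=
    ⟨Fin.init x, x (Fin.last _), (Fin.snoc_init_self x).symm⟩
  have hsplit : twistedD ρ s n f = barD n f + (-1 : ℚ) ^ (n + 1) • ((fun y : Fin (n + 1) → G =>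
      ρ (s (y (Fin.last n)))⁻¹ (f (Fin.init y))) - fun y => f (Fin.init y)) := rfl
  have hsq := congrFun (barD_barD n f) (Fin.snoc x q : Fin (n + 2) → G)
  rw [twistedD, hsplit, barD_add, barD_smul, barD_sub]
  simp only [Pi.add_apply, Pi.sub_apply, Pi.smul_apply, hsq, Pi.zero_apply, barD_snoc,
    Fin.init_snoc, Fin.snoc_last, Fin.snoc_castSucc, front_snoc, mul_inv_rev, map_mul,
    Module.End.mul_apply, map_add, map_sub, map_smul]
  rw [show ρ (s q)⁻¹ (barD n f x) = barD n (fun y => ρ (s q)⁻¹ (f y)) x from map_barD _ _ _ _]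
  obtain hε | hε := neg_one_pow_eq_or ℚ (n + 1) <;> rw [pow_succ _ (n + 1), hε] <;> module

end TwistedCoboundary

section FreeRepresentation

open Representation

variable {Γ Y V : Type} [Group Γ] [AddCommGroup V] [Module ℚ V]

/-- The basis vector `[y]` of the free representation `ℚ[Γ]^Y`. -/
def freeBasis (Γ : Type) [Group Γ] {Y : Type} (y : Y) : Y →₀ MonoidAlgebra ℚ Γ :=
  Finsupp.single y (.single 1 1)

theorem free_apply (γ : Γ) (a : Y →₀ MonoidAlgebra ℚ Γ) (y : Y) :
    free ℚ Γ Y γ a y = leftRegular ℚ Γ γ (a y) := by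
  classical
  induction a using Finsupp.induction_linear with
  | zero => simp
  | add a b ha hb => simp only [map_add, Finsupp.add_apply, ha, hb]
  | single z b =>
    rw [finsupp_single, Finsupp.single_apply, Finsupp.single_apply]
    split_ifs <;> simp

theorem free_freeBasis (γ : Γ) (y : Y) :
    free ℚ Γ Y γ (freeBasis Γ y) = Finsupp.single y (.single γ 1) := by
  rw [freeBasis, free_single_single, mul_one]

theorem free_linearMap_ext {f h : (Y →₀ MonoidAlgebra ℚ Γ) →ₗ[ℚ] V}
    (H : ∀ (y : Y) (γ : Γ), f (free ℚ Γ Y γ (freeBasis Γ y)) =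
      h (free ℚ Γ Y γ (freeBasis Γ y))) : f = h := by
  ext y γ
  have h := H y γ
  rwa [free_freeBasis] at h

theorem free_intertwiningMap_ext {σ : Representation ℚ Γ V}
    {f h : IntertwiningMap (free ℚ Γ Y) σ}
    (H : ∀ y : Y, f (freeBasis Γ y) = h (freeBasis Γ y)) : f = h :=
  (freeLiftLEquiv σ Y).injective (funext H)

theorem freeLift_freeBasis (σ : Representation ℚ Γ V) (f : Y → V) (y : Y) :
    freeLift σ f (freeBasis Γ y) = f y := by
  rw [freeBasis, freeLift_single_single, map_one, one_smul, Module.End.one_apply]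

end FreeRepresentation

namespace CentralElement

open Representation

variable {Γ V W Y : Type} [Group Γ] [AddCommGroup V] [Module ℚ V] [AddCommGroup W] [Module ℚ W]
  (g : CentralElement Γ)

section Shift

variable (ρ : Representation ℚ Γ V)

/-- The endomorphism `g - 1` of a representation. -/
def shift : IntertwiningMap ρ ρ :=
  IntertwiningMap.centralMul ρ g.val (Submonoid.mem_center_iff.2 fun x => by
    simpa using g.comm x 1) - IntertwiningMap.id ρ

theorem shift_apply (v : V) : g.shift ρ v = ρ g.val v - v := rfl

/-- Multiplication by the Laurent polynomial `(g ^ k - 1) / (g - 1)`. -/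
def geom (k : ℤ) : V →ₗ[ℚ] V :=
  ∑ i ∈ Finset.Ico 0 k, ρ (g.val ^ i) - ∑ i ∈ Finset.Ico k 0, ρ (g.val ^ i)

theorem shift_sum_Ico {m n : ℤ} (h : m ≤ n) (v : V) :
    g.shift ρ (∑ i ∈ Finset.Ico m n, ρ (g.val ^ i) v) = ρ (g.val ^ n) v - ρ (g.val ^ m) v := by
  induction n, h using Int.leInduction with
  | base => simp
  | succ n hn ih =>
    rw [← Finset.insert_Ico_right_eq_Ico_add_one hn, Finset.sum_insert (by simp), map_add, ih,
      shift_apply, add_comm n 1, zpow_one_add, map_mul, Module.End.mul_apply]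
    abel

theorem shift_geom (k : ℤ) (v : V) : g.shift ρ (g.geom ρ k v) = ρ (g.val ^ k) v - v := by
  simp only [geom, LinearMap.sub_apply, LinearMap.sum_apply, map_sub]
  obtain hk | hk := le_total 0 k
  · simp [g.shift_sum_Ico ρ hk, Finset.Ico_eq_empty_of_le hk]
  · simp [g.shift_sum_Ico ρ hk, Finset.Ico_eq_empty_of_le hk]

variable {ρ}

theorem map_shift_eq_zero (φ : IntertwiningMap ρ (trivial ℚ Γ W)) (v : V) :
    φ (g.shift ρ v) = 0 := by
  rw [shift_apply, map_sub, φ.isIntertwining, trivial_apply, sub_self]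

theorem map_geom (φ : IntertwiningMap ρ (trivial ℚ Γ W)) (k : ℤ) (v : V) :
    φ (g.geom ρ k v) = (k : ℚ) • φ v := by
  simp only [geom, LinearMap.sub_apply, LinearMap.sum_apply, map_sub, map_sum, φ.isIntertwining,
    trivial_apply, Finset.sum_const, Int.card_Ico, ← Nat.cast_smul_eq_nsmul ℚ, ← sub_smul]
  congr 1
  exact_mod_cast (by omega : (((k - 0).toNat : ℤ) - ((0 - k).toNat : ℤ)) = k)

end Shift

theorem shift_free_injective : Function.Injective (g.shift (free ℚ Γ Y)) := by
  refine (injective_iff_map_eq_zero _).2 fun a ha => ?_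
  have hinv (y : Y) (γ : Γ) : (a y).coeff (g.val⁻¹ * γ) = (a y).coeff γ := by
    have h : (free ℚ Γ Y g.val a y).coeff γ = (a y).coeff γ :=
      congrArg (fun b => (b y).coeff γ) (sub_eq_zero.1 ha : free ℚ Γ Y g.val a = a)
    rwa [free_apply, coeff_ofMulAction, smul_eq_mul] at h
  have hpow (y : Y) (γ : Γ) (k : ℕ) : (a y).coeff (g.val⁻¹ ^ k * γ) = (a y).coeff γ := by
    induction k with
    | zero => simp
    | succ k ih => rw [pow_succ', mul_assoc, hinv, ih]
  ext y γ
  by_contra hne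
  refine Set.infinite_of_injective_forall_mem (f := fun k : ℕ => g.val⁻¹ ^ k * γ)
    (s := ((a y).coeff.support : Set Γ)) (fun i j hij => ?_) (fun k => ?_)
    (a y).coeff.support.finite_toSet
  · have h : g.val ^ (i : ℤ) = g.val ^ (j : ℤ) := by simpa using mul_right_cancel hij
    exact_mod_cast g.zpow_injective h
  · exact Finsupp.mem_support_iff.2 (by rw [hpow]; exact hne)

section BarResolution

/-- Bar chains of `Γ ⧸ ⟨g⟩` with coefficients in `ℚ[Γ]`. -/
abbrev barRep (n : ℕ) : Representation ℚ Γ ((Fin n → g.BaseGroup) →₀ MonoidAlgebra ℚ Γ) :=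
  free ℚ Γ (Fin n → g.BaseGroup)

/-- The bar boundary with coefficients in `ℚ[Γ]`, whose last face is twisted by the chosen lift.
It does not square to zero because the lift is not multiplicative. -/
def boundary (n : ℕ) : IntertwiningMap (g.barRep (n + 1)) (g.barRep n) :=
  freeLift _ (twistedD (g.barRep n) g.lift n (freeBasis Γ))

/-- The square of the twisted bar boundary, divided by `g - 1`. -/
def divided (n : ℕ) : IntertwiningMap (g.barRep (n + 2)) (g.barRep n) :=
  freeLift _ fun x => -g.geom (g.barRep n)
    (-g.eulerFun (x (Fin.last n).castSucc) (x (Fin.last (n + 1))))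
    (g.barRep n (g.lift (x (Fin.last n).castSucc * x (Fin.last (n + 1))))⁻¹
      (freeBasis Γ (front x)))

theorem boundary_freeBasis (n : ℕ) (x : Fin (n + 1) → g.BaseGroup) :
    g.boundary n (freeBasis Γ x) = twistedD (g.barRep n) g.lift n (freeBasis Γ) x :=
  freeLift_freeBasis _ _ _

theorem boundary_boundary (n : ℕ) (a) :
    g.boundary n (g.boundary (n + 1) a) = g.shift (g.barRep n) (g.divided n a) := by
  suffices h : (g.boundary n).comp (g.boundary (n + 1)) =
      (g.shift (g.barRep n)).comp (g.divided n) from DFunLike.congr_fun h a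
  refine free_intertwiningMap_ext fun x => ?_
  have hlift (p q : g.BaseGroup) : (g.lift p * g.lift q)⁻¹ =
      g.val ^ (-g.eulerFun p q) * (g.lift (p * q))⁻¹ := by
    rw [g.eulerFun_spec, mul_inv_rev, ← zpow_neg, g.comm]
  rw [IntertwiningMap.comp_apply, IntertwiningMap.comp_apply, boundary_freeBasis, map_twistedD,
    divided, freeLift_freeBasis, map_neg, shift_geom]
  simp only [Function.comp_def, boundary_freeBasis]
  rw [twistedD_twistedD, hlift, map_mul, Module.End.mul_apply, neg_sub]

/-- A contraction of the twisted bar chains modulo `g - 1`. -/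
def contraction (n : ℕ) :
    ((Fin n → g.BaseGroup) →₀ MonoidAlgebra ℚ Γ) →ₗ[ℚ]
      ((Fin (n + 1) → g.BaseGroup) →₀ MonoidAlgebra ℚ Γ) :=
  Finsupp.lsum ℚ fun x => (Finsupp.linearCombination ℚ fun γ : Γ => (-1 : ℚ) ^ (n + 1) •
      freeBasis Γ (Fin.snoc x (γ⁻¹ : g.BaseGroup) : Fin (n + 1) → g.BaseGroup)) ∘ₗ
    (MonoidAlgebra.coeffLinearEquiv ℚ).toLinearMap

theorem contraction_free_freeBasis (n : ℕ) (γ : Γ) (x : Fin n → g.BaseGroup) :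
    g.contraction n (g.barRep n γ (freeBasis Γ x)) = (-1 : ℚ) ^ (n + 1) •
      freeBasis Γ (Fin.snoc x (γ⁻¹ : g.BaseGroup) : Fin (n + 1) → g.BaseGroup) := by
  rw [free_freeBasis]
  simp [contraction]

theorem contraction_shift (n : ℕ) (a) : g.contraction n (g.shift (g.barRep n) a) = 0 := by
  suffices h : g.contraction n ∘ₗ (g.shift (g.barRep n)).toLinearMap = 0 from
    LinearMap.congr_fun h a
  refine free_linearMap_ext fun x γ => ?_
  have hg : (g.val : g.BaseGroup) = 1 :=
    (QuotientGroup.eq_one_iff _).2 (Subgroup.mem_zpowers _)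
  rw [LinearMap.comp_apply, IntertwiningMap.toLinearMap_apply, shift_apply, map_sub,
    ← Module.End.mul_apply, ← map_mul, contraction_free_freeBasis, contraction_free_freeBasis,
    QuotientGroup.mk_mul, hg, one_mul, sub_self, LinearMap.zero_apply]

theorem sub_lift_inv_mem_range_shift (ρ : Representation ℚ Γ V) (γ : Γ) (v : V) :
    ρ γ v - ρ (g.lift (γ⁻¹ : g.BaseGroup))⁻¹ v ∈ LinearMap.range (g.shift ρ).toLinearMap := by
  obtain ⟨k, hk⟩ := QuotientGroup.eq.1
    ((g.mk_lift (γ⁻¹ : g.BaseGroup)).trans (QuotientGroup.mk_inv _ γ).symm)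
  refine ⟨g.geom ρ (-k) (ρ (g.lift (γ⁻¹ : g.BaseGroup))⁻¹ v), ?_⟩
  have hγ : g.val ^ (-k) * (g.lift (γ⁻¹ : g.BaseGroup))⁻¹ = γ := by
    rw [zpow_neg, ← mul_inv_rev, show g.val ^ k = _ from hk, mul_inv_cancel_left, inv_inv]
  rw [IntertwiningMap.toLinearMap_apply, shift_geom, ← Module.End.mul_apply, ← map_mul, hγ]

theorem contraction_homotopy (n : ℕ) (a) :
    a - g.boundary (n + 1) (g.contraction (n + 1) a) - g.contraction n (g.boundary n a) ∈
      LinearMap.range (g.shift (g.barRep (n + 1))).toLinearMap := by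
  suffices h : (LinearMap.range (g.shift (g.barRep (n + 1))).toLinearMap).mkQ ∘ₗ (LinearMap.id -
      (g.boundary (n + 1)).toLinearMap ∘ₗ g.contraction (n + 1) -
        g.contraction n ∘ₗ (g.boundary n).toLinearMap) = 0 from
    (Submodule.Quotient.mk_eq_zero _).1 (LinearMap.congr_fun h a)
  refine free_linearMap_ext fun x γ => (Submodule.Quotient.mk_eq_zero _).2 ?_
  convert g.sub_lift_inv_mem_range_shift (g.barRep (n + 1)) γ (freeBasis Γ x) using 1
  have hcontr : g.contraction n (g.barRep n γ (barD n (freeBasis Γ) x)) =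
      (-1 : ℚ) ^ (n + 1) • barD n (fun y => freeBasis Γ
        (Fin.snoc y (γ⁻¹ : g.BaseGroup) : Fin (n + 1) → g.BaseGroup)) x := by
    have h := map_barD (g.contraction n ∘ₗ g.barRep n γ) n (freeBasis Γ) x
    simp only [Function.comp_def, LinearMap.comp_apply, contraction_free_freeBasis] at h
    exact h.trans (congrFun (barD_smul n _ _) x)
  have hcomp (q : g.BaseGroup) (y : Fin n → g.BaseGroup) :
      g.contraction n (g.barRep n γ (g.barRep n (g.lift q)⁻¹ (freeBasis Γ y))) =
        (-1 : ℚ) ^ (n + 1) • freeBasis Γ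
          (Fin.snoc y (q * (γ⁻¹ : g.BaseGroup)) : Fin (n + 1) → g.BaseGroup) := by
    rw [← Module.End.mul_apply, ← map_mul, contraction_free_freeBasis]
    simp only [QuotientGroup.mk_mul, QuotientGroup.mk_inv, mul_inv_rev, inv_inv, mk_lift]
  simp only [LinearMap.sub_apply, LinearMap.comp_apply, LinearMap.id_apply,
    IntertwiningMap.toLinearMap_apply, contraction_free_freeBasis, IntertwiningMap.isIntertwining,
    boundary_freeBasis, map_smul, twistedD, map_add, map_sub, hcontr, hcomp, barD_snoc,
    Fin.init_snoc, Fin.snoc_last]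
  obtain hε | hε := neg_one_pow_eq_or ℚ (n + 1) <;> rw [pow_succ _ (n + 1), hε] <;> module

/-- The sum of the coefficients of a chain of degree `0`. -/
def augmentation : IntertwiningMap (g.barRep 0) (trivial ℚ Γ ℚ) := freeLift _ fun _ => 1

theorem augmentation_freeBasis (x : Fin 0 → g.BaseGroup) : g.augmentation (freeBasis Γ x) = 1 :=
  freeLift_freeBasis _ _ _

theorem augmentation_surjective : Function.Surjective g.augmentation := fun r =>
  ⟨r • freeBasis Γ Fin.elim0, by rw [map_smul, augmentation_freeBasis, smul_eq_mul, mul_one]⟩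

theorem augmentation_boundary (a) : g.augmentation (g.boundary 0 a) = 0 := by
  suffices h : g.augmentation.comp (g.boundary 0) = 0 from DFunLike.congr_fun h a
  refine free_intertwiningMap_ext fun x => ?_
  rw [IntertwiningMap.comp_apply, boundary_freeBasis, map_twistedD, twistedD_trivial]
  simp [barD, augmentation_freeBasis]

theorem contraction_homotopy_zero (a) :
    a - g.boundary 0 (g.contraction 0 a) - g.augmentation a • freeBasis Γ Fin.elim0 ∈
      LinearMap.range (g.shift (g.barRep 0)).toLinearMap := by
  suffices h : (LinearMap.range (g.shift (g.barRep 0)).toLinearMap).mkQ ∘ₗ (LinearMap.id -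
      (g.boundary 0).toLinearMap ∘ₗ g.contraction 0 -
        g.augmentation.toLinearMap.smulRight (freeBasis Γ Fin.elim0)) = 0 from
    (Submodule.Quotient.mk_eq_zero _).1 (LinearMap.congr_fun h a)
  refine free_linearMap_ext fun x γ => (Submodule.Quotient.mk_eq_zero _).2 ?_
  convert g.sub_lift_inv_mem_range_shift (g.barRep 0) γ (freeBasis Γ x) using 1
  have hx (y : Fin 0 → g.BaseGroup) : y = Fin.elim0 := Subsingleton.elim _ _
  simp only [LinearMap.sub_apply, LinearMap.comp_apply, LinearMap.id_apply,
    LinearMap.smulRight_apply, IntertwiningMap.toLinearMap_apply, contraction_free_freeBasis,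
    map_smul, boundary_freeBasis, IntertwiningMap.isIntertwining, augmentation_freeBasis,
    trivial_apply, twistedD, barD, hx]
  rw [Fin.snoc_last, Fin.sum_univ_one, Fin.val_zero]
  module

end BarResolution

end CentralElement

theorem prod_projective {Γ : Type} [Group Γ] {A B : Rep.{0} ℚ Γ} (hA : Projective A)
    (hB : Projective B) : Projective (Rep.of (A.ρ.prod B.ρ)) where
  factors {E X} f e _ := by
    let i : A ⟶ Rep.of (A.ρ.prod B.ρ) := Rep.ofHom (.inl ℚ A.ρ B.ρ)
    let j : B ⟶ Rep.of (A.ρ.prod B.ρ) := Rep.ofHom (.inr ℚ A.ρ B.ρ)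
    let p : Rep.of (A.ρ.prod B.ρ) ⟶ A := Rep.ofHom (.fst ℚ A.ρ B.ρ)
    let q : Rep.of (A.ρ.prod B.ρ) ⟶ B := Rep.ofHom (.snd ℚ A.ρ B.ρ)
    have hid : p ≫ i + q ≫ j = 𝟙 _ := by
      ext1
      simp [Rep.add_hom, p, q, i, j]
    refine ⟨p ≫ Projective.factorThru (i ≫ f) e + q ≫ Projective.factorThru (j ≫ f) e, ?_⟩
    rw [Preadditive.add_comp, Category.assoc, Category.assoc, Projective.factorThru_comp,
      Projective.factorThru_comp, ← Category.assoc, ← Category.assoc, ← Preadditive.add_comp, hid,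
      Category.id_comp]

namespace CentralElement

open Representation

variable {Γ : Type} [Group Γ] (g : CentralElement Γ)

section ConeResolution

/-- The first component of the cone differential, `(a, b) ↦ ∂a + (g - 1)b`. -/
def coneTop (n : ℕ) :
    IntertwiningMap ((g.barRep (n + 1)).prod (g.barRep n)) (g.barRep n) :=
  (g.boundary n).comp (.fst ℚ _ _) + (g.shift (g.barRep n)).comp (.snd ℚ _ _)

/-- The second component of the cone differential, `(a, b) ↦ -ha - ∂b` where `(g - 1)h = ∂²`. -/
def coneBot (n : ℕ) :
    IntertwiningMap ((g.barRep (n + 2)).prod (g.barRep (n + 1))) (g.barRep n) :=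
  -(g.divided n).comp (.fst ℚ _ _) - (g.boundary n).comp (.snd ℚ _ _)

theorem coneTop_apply (n : ℕ) (p) :
    g.coneTop n p = g.boundary n p.1 + g.shift (g.barRep n) p.2 := rfl

theorem coneBot_apply (n : ℕ) (p) : g.coneBot n p = -g.divided n p.1 - g.boundary n p.2 := rfl

theorem boundary_shift (n : ℕ) (a) :
    g.boundary n (g.shift (g.barRep (n + 1)) a) = g.shift (g.barRep n) (g.boundary n a) := by
  rw [shift_apply, shift_apply, map_sub, IntertwiningMap.isIntertwining]

theorem shift_coneBot (n : ℕ) (p) :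
    g.shift (g.barRep n) (g.coneBot n p) = -g.boundary n (g.coneTop (n + 1) p) := by
  rw [coneBot_apply, coneTop_apply, map_sub, map_neg, map_add, boundary_boundary, boundary_shift]
  abel

theorem coneBot_eq_zero (n : ℕ) (p) (hp : g.coneTop (n + 1) p = 0) : g.coneBot n p = 0 := by
  refine g.shift_free_injective ?_
  rw [shift_coneBot, hp, map_zero, map_zero, neg_zero]

theorem coneTop_coneTop_coneBot (n : ℕ) (p) :
    g.coneTop n (g.coneTop (n + 1) p, g.coneBot n p) = 0 := by
  rw [coneTop_apply, shift_coneBot, add_neg_cancel]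

theorem exists_coneTop_eq (n : ℕ) (p) (hp : g.coneTop n p = 0) :
    ∃ p', g.coneTop (n + 1) p' = p.1 := by
  obtain ⟨b, hb⟩ := g.contraction_homotopy n p.1
  refine ⟨(g.contraction (n + 1) p.1, b), ?_⟩
  have hboundary : g.boundary n p.1 = -g.shift (g.barRep n) p.2 := eq_neg_of_add_eq_zero_left hp
  rw [hboundary, map_neg, contraction_shift, neg_zero, sub_zero] at hb
  rw [coneTop_apply]
  exact add_eq_of_eq_sub' hb

theorem exists_coneTop_coneBot_eq (n : ℕ) (p) (hp : g.coneTop n p = 0) :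
    ∃ p', (g.coneTop (n + 1) p', g.coneBot n p') = p := by
  obtain ⟨p', hp'⟩ := g.exists_coneTop_eq n p hp
  refine ⟨p', Prod.ext hp' (g.shift_free_injective ?_)⟩
  rw [shift_coneBot, hp', ← sub_eq_zero, sub_eq_add_neg, ← neg_add, neg_eq_zero]
  exact hp

theorem exists_coneTop_zero_eq (a) (ha : g.augmentation a = 0) : ∃ p, g.coneTop 0 p = a := by
  obtain ⟨b, hb⟩ := g.contraction_homotopy_zero a
  refine ⟨(g.contraction 0 a, b), ?_⟩
  rw [ha, zero_smul, sub_zero] at hb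
  rw [coneTop_apply]
  exact add_eq_of_eq_sub' hb

theorem augmentation_coneTop (p) : g.augmentation (g.coneTop 0 p) = 0 := by
  rw [coneTop_apply, map_add, augmentation_boundary, map_shift_eq_zero, add_zero]

/-- The terms of the mapping cone of `g - 1` on the twisted bar chains. -/
def coneX : ℕ → Rep.{0} ℚ Γ
  | 0 => Rep.of (g.barRep 0)
  | n + 1 => Rep.of ((g.barRep (n + 1)).prod (g.barRep n))

/-- The differential of the mapping cone of `g - 1` on the twisted bar chains. -/
def coneD : (n : ℕ) → (g.coneX (n + 1) ⟶ g.coneX n)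
  | 0 => Rep.ofHom (g.coneTop 0)
  | n + 1 => Rep.ofHom ((g.coneTop (n + 1)).prod (g.coneBot n))

theorem coneD_hom_eq_zero_iff (n : ℕ) (p) : (g.coneD n).hom p = 0 ↔ g.coneTop n p = 0 := by
  cases n with
  | zero => exact Iff.rfl
  | succ n =>
    exact ⟨congrArg Prod.fst, fun hp => Prod.ext hp (g.coneBot_eq_zero n _ hp)⟩

theorem coneD_comp (n : ℕ) : g.coneD (n + 1) ≫ g.coneD n = 0 := by
  ext p
  exact (g.coneD_hom_eq_zero_iff n _).2 (g.coneTop_coneTop_coneBot n p)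

theorem exists_coneD_eq (n : ℕ) (p) (hp : (g.coneD n).hom p = 0) :
    ∃ p', (g.coneD (n + 1)).hom p' = p :=
  g.exists_coneTop_coneBot_eq n p ((g.coneD_hom_eq_zero_iff n p).1 hp)

/-- The mapping cone of `g - 1` on the twisted bar chains, a resolution of `ℚ` by free
representations. -/
def coneComplex : ChainComplex (Rep.{0} ℚ Γ) ℕ :=
  ChainComplex.of g.coneX g.coneD g.coneD_comp

theorem coneComplex_d (n : ℕ) : g.coneComplex.d (n + 1) n = g.coneD n :=
  ChainComplex.of_d _ _ _

theorem coneX_projective (n : ℕ) : Projective (g.coneX n) := by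
  cases n with
  | zero => exact Rep.free_projective
  | succ n => exact prod_projective Rep.free_projective Rep.free_projective

/-- The augmentation of the mapping cone. -/
def coneAugmentation : g.coneComplex.X 0 ⟶ Rep.trivial ℚ Γ ℚ := Rep.ofHom g.augmentation

theorem coneComplex_d_comp_coneAugmentation :
    g.coneComplex.d 1 0 ≫ g.coneAugmentation = 0 := by
  rw [coneComplex_d]
  ext p
  exact g.augmentation_coneTop p

/-- The augmentation of the mapping cone, as a chain map. -/
def coneπ : g.coneComplex ⟶ (ChainComplex.single₀ (Rep.{0} ℚ Γ)).obj (Rep.trivial ℚ Γ ℚ) :=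
  (g.coneComplex.toSingle₀Equiv _).symm
    ⟨g.coneAugmentation, g.coneComplex_d_comp_coneAugmentation⟩

theorem quasiIsoAt_zero_coneπ : QuasiIsoAt g.coneπ 0 := by
  rw [ChainComplex.quasiIsoAt₀_iff, ShortComplex.quasiIso_iff_of_zeros' _ rfl rfl rfl]
  constructor
  · apply (forget₂ _ (ModuleCat ℚ)).reflects_exact_of_faithful
    rw [ShortComplex.moduleCat_exact_iff]
    intro a ha
    obtain ⟨p, hp⟩ := g.exists_coneTop_zero_eq a ha
    refine ⟨p, (?_ : (g.coneComplex.d 1 0).hom p = a)⟩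
    rw [coneComplex_d]
    exact hp
  · rw [Rep.epi_iff_surjective]
    exact g.augmentation_surjective

theorem coneComplex_exactAt_succ (n : ℕ) : g.coneComplex.ExactAt (n + 1) := by
  rw [HomologicalComplex.exactAt_iff' _ (n + 2) (n + 1) n (by simp) (by simp)]
  apply (forget₂ _ (ModuleCat ℚ)).reflects_exact_of_faithful
  rw [ShortComplex.moduleCat_exact_iff]
  intro p (hp : (g.coneComplex.d (n + 1) n).hom p = 0)
  change ∃ p', (g.coneComplex.d (n + 2) (n + 1)).hom p' = p
  rw [coneComplex_d] at hp ⊢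
  exact g.exists_coneD_eq n p hp

/-- The projective resolution of the trivial representation attached to a central element. -/
def coneResolution : ProjectiveResolution (Rep.trivial ℚ Γ ℚ) where
  complex := g.coneComplex
  projective := g.coneX_projective
  π := g.coneπ
  quasiIso.quasiIsoAt
    | 0 => g.quasiIsoAt_zero_coneπ
    | n + 1 => (quasiIsoAt_iff_exactAt' _ _ (ChainComplex.exactAt_succ_single_obj ..)).2
        (g.coneComplex_exactAt_succ n)

end ConeResolution

end CentralElement

theorem exists_d_comp_eq {Γ : Type} [Group Γ] {A : Rep.{0} ℚ Γ} {n : ℕ}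
    (P : ProjectiveResolution (Rep.trivial ℚ Γ ℚ))
    (hA : Limits.IsZero (groupCohomology A (n + 1))) (Φ : P.complex.X (n + 1) ⟶ A)
    (hΦ : P.complex.d (n + 2) (n + 1) ≫ Φ = 0) : ∃ Ψ, P.complex.d (n + 1) n ≫ Ψ = Φ := by
  have hexact := hA.of_iso (groupCohomologyIso A (n + 1) P).symm
  rw [← HomologicalComplex.exactAt_iff_isZero_homology,
    HomologicalComplex.exactAt_iff' _ n (n + 1) (n + 2) (by simp) (by simp),
    ShortComplex.moduleCat_exact_iff] at hexact
  exact hexact Φ hΦ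

namespace CentralElement

open Representation

variable {Γ W : Type} [Group Γ] [AddCommGroup W] [Module ℚ W] (g : CentralElement Γ)

section GysinSequence

theorem map_boundary_freeBasis {n : ℕ} (φ : IntertwiningMap (g.barRep n) (trivial ℚ Γ W))
    (x : Fin (n + 1) → g.BaseGroup) :
    φ (g.boundary n (freeBasis Γ x)) = barD n (fun y => φ (freeBasis Γ y)) x := by
  rw [boundary_freeBasis, map_twistedD, twistedD_trivial, Function.comp_def]

theorem freeLift_boundary {n : ℕ} (f : (Fin n → g.BaseGroup) → W) (a) :
    freeLift (trivial ℚ Γ W) f (g.boundary n a) = freeLift (trivial ℚ Γ W) (barD n f) a := by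
  suffices h : (freeLift (trivial ℚ Γ W) f).comp (g.boundary n) = freeLift _ (barD n f) from
    DFunLike.congr_fun h a
  refine free_intertwiningMap_ext fun x => ?_
  rw [IntertwiningMap.comp_apply, map_boundary_freeBasis]
  simp only [freeLift_freeBasis]

theorem freeLift_divided {n : ℕ} (f : (Fin n → g.BaseGroup) → W) (a) :
    freeLift (trivial ℚ Γ W) f (g.divided n a) =
      freeLift (trivial ℚ Γ W) (fun x => weight g.eulerCocycle x • f (front x)) a := by
  suffices h : (freeLift (trivial ℚ Γ W) f).comp (g.divided n) = freeLift _ _ from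
    DFunLike.congr_fun h a
  refine free_intertwiningMap_ext fun x => ?_
  rw [IntertwiningMap.comp_apply, divided, freeLift_freeBasis, freeLift_freeBasis, map_neg,
    map_geom, IntertwiningMap.isIntertwining, trivial_apply, freeLift_freeBasis, Int.cast_neg,
    neg_smul, neg_neg]
  rfl

theorem freeLift_coneTop_add_freeLift_coneBot {n : ℕ} {α : (Fin (n + 2) → g.BaseGroup) → W}
    {β : (Fin (n + 1) → g.BaseGroup) → W} (hβ : barD (n + 1) β = 0)
    (hα : barD (n + 2) α = fun x => weight g.eulerCocycle x • β (front x)) (p) :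
    freeLift (trivial ℚ Γ W) α (g.coneTop (n + 2) p) +
      freeLift (trivial ℚ Γ W) β (g.coneBot (n + 1) p) = 0 := by
  have hzero : freeLift (trivial ℚ Γ W) (0 : (Fin (n + 2) → g.BaseGroup) → W) = 0 :=
    map_zero (freeLiftLEquiv (trivial ℚ Γ W) _).symm
  have hshift := g.map_shift_eq_zero (freeLift (trivial ℚ Γ W) α) p.2
  rw [coneTop_apply, coneBot_apply, map_add, map_sub, map_neg, freeLift_boundary,
    freeLift_boundary, freeLift_divided, hshift, hα, hβ, hzero, add_zero]
  change _ + (_ - 0) = _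
  rw [sub_zero, add_neg_cancel]

theorem exists_barD_eq_of_barD_eq_weight_smul {n : ℕ}
    (hΓ : Limits.IsZero (groupCohomology (Rep.trivial ℚ Γ W) (n + 2)))
    {α : (Fin (n + 2) → g.BaseGroup) → W} {β : (Fin (n + 1) → g.BaseGroup) → W}
    (hβ : barD (n + 1) β = 0)
    (hα : barD (n + 2) α = fun x => weight g.eulerCocycle x • β (front x)) :
    ∃ β' : (Fin n → g.BaseGroup) → W, barD n β' = β := by
  -- Together `α` and `β` are a cocycle of the cone, and the bottom entry of a primitive of it is a
  -- primitive of `β`.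
  let Φ : g.coneX (n + 2) ⟶ Rep.trivial ℚ Γ W :=
    Rep.ofHom ((freeLift _ α).comp (.fst ℚ _ _) + (freeLift _ β).comp (.snd ℚ _ _))
  obtain ⟨Ψ, hΨ⟩ := exists_d_comp_eq g.coneResolution hΓ Φ (by
    change g.coneComplex.d (n + 3) (n + 2) ≫ Φ = 0
    rw [coneComplex_d]
    ext p
    exact g.freeLift_coneTop_add_freeLift_coneBot hβ hα p)
  replace hΨ : g.coneComplex.d (n + 2) (n + 1) ≫ Ψ = Φ := hΨ
  rw [coneComplex_d] at hΨ
  let ψ : IntertwiningMap ((g.barRep (n + 1)).prod (g.barRep n)) (trivial ℚ Γ W) := Ψ.hom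
  have hψ (p) : ψ (g.coneTop (n + 1) p, g.coneBot n p) =
      freeLift (trivial ℚ Γ W) α p.1 + freeLift (trivial ℚ Γ W) β p.2 :=
    congrArg (fun φ => φ.hom p) hΨ
  refine ⟨fun y => (-ψ.comp (.inr ℚ _ _)) (freeBasis Γ y), funext fun x => ?_⟩
  have hx := hψ (0, freeBasis Γ x)
  rw [coneTop_apply, coneBot_apply, map_zero, map_zero, map_zero, freeLift_freeBasis, zero_add,
    zero_add, neg_zero, zero_sub] at hx
  have hshift := g.map_shift_eq_zero (ψ.comp (.inl ℚ _ _)) (freeBasis Γ x)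
  have hsplit : ∀ a b, ψ (a, b) = ψ.comp (.inl ℚ _ _) a + ψ.comp (.inr ℚ _ _) b := fun a b => by
    rw [IntertwiningMap.comp_apply, IntertwiningMap.comp_apply, ← map_add]
    exact congrArg ψ (Prod.ext (add_zero a).symm (zero_add b).symm)
  rw [hsplit, hshift, zero_add, map_neg] at hx
  rw [← map_boundary_freeBasis]
  exact hx

end GysinSequence

end CentralElement

section Homology

variable {R ι : Type} [Ring R] {s : ComplexShape ι} (K : HomologicalComplex (ModuleCat.{0} R) s)

theorem iCycles_injective (i : ι) : Function.Injective (K.iCycles i).hom :=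
  (ModuleCat.mono_iff_injective _).1 inferInstance

theorem homologyπ_surjective (i : ι) : Function.Surjective (K.homologyπ i).hom :=
  (ModuleCat.epi_iff_surjective _).1 inferInstance

theorem homologyπ_eq_zero_iff {i j : ι} (hij : s.Rel i j) (z : K.cycles j) :
    (K.homologyπ j).hom z = 0 ↔ ∃ w, (K.d i j).hom w = (K.iCycles j).hom z := by
  have hexact := ShortComplex.exact_of_g_is_cokernel
    (ShortComplex.mk _ _ (K.toCycles_comp_homologyπ i j))
    (K.homologyIsCokernel i j (s.prev_eq' hij))
  rw [ShortComplex.moduleCat_exact_iff_range_eq_ker] at hexact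
  rw [← LinearMap.mem_ker, ← hexact, LinearMap.mem_range]
  refine exists_congr fun w => ?_
  rw [← (iCycles_injective K j).eq_iff]
  exact Eq.congr_left (congrArg (fun φ => φ.hom w) (K.toCycles_i i j))

theorem homologyMap_homologyπ_eq {K} {L : HomologicalComplex (ModuleCat.{0} R) s} (φ : K ⟶ L)
    {i : ι} {z : K.cycles i} {w : L.cycles i}
    (h : (φ.f i).hom ((K.iCycles i).hom z) = (L.iCycles i).hom w) :
    (HomologicalComplex.homologyMap φ i).hom ((K.homologyπ i).hom z) = (L.homologyπ i).hom w := by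
  have hw : (HomologicalComplex.cyclesMap φ i).hom z = w := iCycles_injective L i
    ((congrArg (fun ψ => ψ.hom z) (HomologicalComplex.cyclesMap_i φ i)).trans h)
  rw [← hw]
  exact congrArg (fun ψ => ψ.hom z) (HomologicalComplex.homologyπ_naturality φ i)

end Homology

section Duality

variable {G : Type} [Group G]

/-- Cochains as functionals on the bar chains. -/
def evalChains {n : ℕ} : ((Fin n → G) → ℚ) ≃ₗ[ℚ] Module.Dual ℚ ((chains G).X n) :=
  Finsupp.llift ℚ ℚ ℚ (Fin n → G)

theorem evalChains_single {n : ℕ} (f : (Fin n → G) → ℚ) (x : Fin n → G) :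
    evalChains f (Finsupp.single x (1 : ℚ) : (Fin n → G) →₀ ℚ) = f x :=
  (Finsupp.sum_single_index (zero_smul ℚ (f x))).trans (one_smul ℚ (f x))

theorem chains_linearMap_ext {n : ℕ} {φ ψ : Module.Dual ℚ ((chains G).X n)}
    (h : ∀ x, φ (Finsupp.single x (1 : ℚ) : (Fin n → G) →₀ ℚ) =
      ψ (Finsupp.single x (1 : ℚ) : (Fin n → G) →₀ ℚ)) : φ = ψ :=
  Finsupp.lhom_ext' fun x => LinearMap.ext_ring (h x)

theorem evalChains_comp_d {n : ℕ} (f : (Fin n → G) → ℚ) :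
    evalChains f ∘ₗ ((chains G).d (n + 1) n).hom = evalChains (barD n f) := by
  refine chains_linearMap_ext fun x => ?_
  rw [LinearMap.comp_apply, boundary_single, evalChains_single]
  refine (map_barD (evalChains f) n _ x).trans ?_
  exact congrArg (fun h => barD n h x) (funext (evalChains_single f))

theorem evalChains_comp_capChains (c : TwoCocycle G) {n : ℕ} (f : (Fin n → G) → ℚ) :
    evalChains f ∘ₗ (capChains c n).hom = evalChains fun x => weight c x • f (front x) := by
  refine chains_linearMap_ext fun x => ?_
  rw [LinearMap.comp_apply, capChains_single, evalChains_single]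
  refine (map_smul (evalChains f) _ _).trans ?_
  rw [evalChains_single]

theorem iCycles_capCycles (c : TwoCocycle G) (n : ℕ) (z : (chains G).cycles (n + 2)) :
    ((chains G).iCycles n).hom ((capCycles c n).hom z) =
      (capChains c n).hom (((chains G).iCycles (n + 2)).hom z) :=
  congrArg (fun φ => φ.hom z) ((chains G).liftCycles_i _ _ rfl (capChains_comp_d_eq_zero c n))

theorem capHomology_homologyπ (c : TwoCocycle G) (n : ℕ) (z : (chains G).cycles (n + 2)) :
    (capHomology c n).hom (((chains G).homologyπ (n + 2)).hom z) =
      ((chains G).homologyπ n).hom ((capCycles c n).hom z) :=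
  congrArg (fun φ => φ.hom z) (π_capHomology c n)

theorem exists_evalChains_barD_eq {n : ℕ} (φ : Module.Dual ℚ ((chains G).X (n + 1)))
    (hφ : ∀ v, ((chains G).d (n + 1) n).hom v = 0 → φ v = 0) :
    ∃ f, evalChains (barD n f) = φ := by
  have hrange : φ ∈ LinearMap.range ((chains G).d (n + 1) n).hom.dualMap := by
    rwa [LinearMap.range_dualMap_eq_dualAnnihilator_ker, Submodule.mem_dualAnnihilator]
  obtain ⟨ψ, hψ⟩ := hrange
  refine ⟨evalChains.symm ψ, ?_⟩
  rw [← evalChains_comp_d, LinearEquiv.apply_symm_apply]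
  exact hψ

theorem exists_barD_eq {n : ℕ} [Subsingleton (groupHomology (Rep.trivial ℚ G ℚ) (n + 1))]
    {f : (Fin (n + 1) → G) → ℚ} (hf : barD (n + 1) f = 0) : ∃ f', barD n f' = f := by
  have hexact : (chains G).ExactAt (n + 1) := by
    rw [HomologicalComplex.exactAt_iff_isZero_homology]
    exact ModuleCat.isZero_of_subsingleton (groupHomology (Rep.trivial ℚ G ℚ) (n + 1))
  rw [HomologicalComplex.exactAt_iff' _ (n + 2) (n + 1) n (by simp) (by simp),
    ShortComplex.moduleCat_exact_iff] at hexact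
  obtain ⟨f', hf'⟩ := exists_evalChains_barD_eq (evalChains f) fun v hv => by
    obtain ⟨w, rfl⟩ := hexact v hv
    refine (LinearMap.congr_fun (evalChains_comp_d f) w).trans ?_
    rw [hf, map_zero]
    rfl
  exact ⟨f', evalChains.injective hf'⟩

end Duality

section Nilpotency

theorem cohomologyPower_succ_eq_zero_iff {G : Type} [Group G] (c : TwoCocycle G) (m : ℕ) :
    cohomologyPower c (m + 1) = 0 ↔ ∃ f, barD (2 * m + 1) f = cupPower c (m + 1) := by
  refine (homologyπ_eq_zero_iff (groupCohomology.inhomogeneousCochains (Rep.trivial ℚ G ℚ))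
    (i := 2 * m + 1) rfl _).trans (exists_congr fun f => ?_)
  refine Eq.congr ?_ (groupCohomology.iCocycles_mk _ _)
  exact congrArg (fun φ => φ.hom f) (groupCohomology.inhomogeneousCochains.d_def _ _)

namespace CentralElement

variable {Γ : Type} [Group Γ] (g : CentralElement Γ)

theorem ker_d_le_map_capChains_sup_range_d {n : ℕ}
    (hΓ : Limits.IsZero (groupCohomology (Rep.trivial ℚ Γ ℚ) (n + 2))) :
    LinearMap.ker ((chains g.BaseGroup).d (n + 1) n).hom ≤
      (LinearMap.ker ((chains g.BaseGroup).d (n + 3) (n + 2)).hom).map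
          (capChains g.eulerCocycle (n + 1)).hom ⊔
        LinearMap.range ((chains g.BaseGroup).d (n + 2) (n + 1)).hom := by
  intro v hv
  rw [← Subspace.forall_mem_dualAnnihilator_apply_eq_zero_iff]
  intro φ hφ
  rw [Submodule.mem_dualAnnihilator] at hφ
  obtain ⟨β, rfl⟩ := evalChains.surjective φ
  have hβ : barD (n + 1) β = 0 := by
    rw [← evalChains.map_eq_zero_iff, ← evalChains_comp_d]
    exact LinearMap.ext fun u => hφ _ (Submodule.mem_sup_right ⟨u, rfl⟩)
  obtain ⟨α, hα⟩ := exists_evalChains_barD_eq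
    (evalChains β ∘ₗ (capChains g.eulerCocycle (n + 1)).hom)
    fun u hu => hφ _ (Submodule.mem_sup_left ⟨u, hu, rfl⟩)
  rw [evalChains_comp_capChains, evalChains.injective.eq_iff] at hα
  obtain ⟨β', rfl⟩ := g.exists_barD_eq_of_barD_eq_weight_smul hΓ hβ hα
  rw [← evalChains_comp_d, LinearMap.comp_apply, LinearMap.mem_ker.1 hv, map_zero]

theorem capHomology_surjective {n : ℕ}
    (hΓ : Limits.IsZero (groupCohomology (Rep.trivial ℚ Γ ℚ) (n + 2))) :
    Function.Surjective (capHomology g.eulerCocycle (n + 1)).hom := by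
  let C := chains g.BaseGroup
  intro w
  obtain ⟨z, rfl⟩ := homologyπ_surjective C (n + 1) w
  have hz : (C.d (n + 1) n).hom ((C.iCycles (n + 1)).hom z) = 0 :=
    congrArg (fun φ => φ.hom z) (C.iCycles_d (n + 1) n)
  obtain ⟨_, ⟨y, hy, rfl⟩, _, ⟨u, rfl⟩, hyu⟩ :=
    Submodule.mem_sup.1 (g.ker_d_le_map_capChains_sup_range_d hΓ hz)
  let y' : C.cycles (n + 3) := C.cyclesMk y (n + 2) (by simp) hy
  refine ⟨(C.homologyπ (n + 3)).hom y', ?_⟩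
  have hdiff : (C.homologyπ (n + 1)).hom
      (z - (capCycles g.eulerCocycle (n + 1)).hom y') = 0 := by
    refine (homologyπ_eq_zero_iff C (i := n + 2) (by simp) _).2 ⟨u, ?_⟩
    rw [map_sub, iCycles_capCycles, ← hyu, show (C.iCycles (n + 3)).hom y' = y from
      C.i_cyclesMk _ _ _ _, add_sub_cancel_left]
  rw [map_sub, sub_eq_zero] at hdiff
  exact (capHomology_homologyπ _ _ y').trans hdiff.symm

theorem subsingleton_groupHomology_of_capLimit_eq_bot {n : ℕ} (hlim : g.capLimit n = ⊥)
    (hcap : ∀ k, Function.Surjective (capHomology g.eulerCocycle (n + 2 * k)).hom) :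
    Subsingleton (groupHomology (Rep.trivial ℚ g.BaseGroup ℚ) n) := by
  refine subsingleton_of_forall_eq 0 fun z₀ => ?_
  choose preimage hpreimage using hcap
  let z (k : ℕ) : groupHomology (Rep.trivial ℚ g.BaseGroup ℚ) (n + 2 * k) :=
    Nat.rec (motive := fun k => groupHomology (Rep.trivial ℚ g.BaseGroup ℚ) (n + 2 * k)) z₀
      (fun k => preimage k) k
  have hz : z ∈ g.capLimit n := fun k => hpreimage k (z k)
  rw [hlim, Submodule.mem_bot] at hz
  exact congrFun hz 0

theorem exists_cohomologyPower_succ_eq_zero (hlim : ∀ n, g.capLimit n = ⊥)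
    (hcd : HasFiniteRationalCD Γ) : ∃ m, cohomologyPower g.eulerCocycle (m + 1) = 0 := by
  obtain ⟨d, hd⟩ := hcd
  have hhomology : Subsingleton (groupHomology (Rep.trivial ℚ g.BaseGroup ℚ) (2 * d + 1 + 1)) :=
    g.subsingleton_groupHomology_of_capLimit_eq_bot (hlim _) fun k => by
      rw [show 2 * d + 1 + 1 + 2 * k = 2 * d + 1 + 2 * k + 1 by omega]
      exact g.capHomology_surjective (hd _ _ (by omega))
  exact ⟨d, (cohomologyPower_succ_eq_zero_iff _ _).2
    (exists_barD_eq (d_cupPower g.eulerCocycle (d + 1)))⟩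

end CentralElement

end Nilpotency

section SimplicialCup

open scoped Simplicial

variable {X : SSet.{0}} {R : Type} [CommRing R]

/-- The coboundary of a simplicial cochain, the alternating sum over the faces. -/
def faceD {n : ℕ} (f : X _⦋n⦌ → R) (y : X _⦋n + 1⦌) : R :=
  ∑ i : Fin (n + 2), (-1) ^ (i : ℕ) * f (X.δ i y)

/-- The inclusion of the last `k + 1` vertices of the standard simplex. -/
def lastVertices (n k : ℕ) : ⦋k⦌ ⟶ ⦋n + k⦌ :=
  SimplexCategory.mkHom ⟨fun i => Fin.natAdd n i, fun _ _ h => Fin.natAdd_le_natAdd_iff n |>.2 h⟩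

/-- The back face of a simplex, spanned by its last `k + 1` vertices. -/
def lastFace (n k : ℕ) (z : X _⦋n + k⦌) : X _⦋k⦌ := X.map (lastVertices n k).op z

/-- The front face of a simplex, which omits its last two vertices. -/
def frontFace {n : ℕ} (z : X _⦋n + 2⦌) : X _⦋n⦌ :=
  X.δ (Fin.last (n + 1)) (X.δ (Fin.last (n + 2)) z)

theorem lastVertices_comp_δ_of_le {n : ℕ} (i : Fin (n + 4)) (hi : (i : ℕ) ≤ n) :
    lastVertices n 2 ≫ SimplexCategory.δ i = lastVertices (n + 1) 2 := by
  ext j : 3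
  apply Fin.ext
  change ((i.succAbove (Fin.natAdd n j) : Fin (n + 4)) : ℕ) =
    ((Fin.natAdd (n + 1) j : Fin (n + 1 + 3)) : ℕ)
  rw [Fin.succAbove_of_le_castSucc, Fin.val_succ, Fin.val_natAdd, Fin.val_natAdd]
  · omega
  · exact Fin.le_def.2 (hi.trans (Nat.le_add_right n j))

theorem lastVertices_comp_δ_natAdd (n : ℕ) {k : ℕ} (i : Fin (k + 2)) :
    lastVertices n k ≫ SimplexCategory.δ (Fin.natAdd n i) =
      SimplexCategory.δ i ≫ lastVertices n (k + 1) := by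
  ext j : 3
  apply Fin.ext
  change (((Fin.natAdd n i).succAbove (Fin.natAdd n j) : Fin (n + (k + 2))) : ℕ) =
    ((Fin.natAdd n (Fin.succAbove i j) : Fin (n + (k + 2))) : ℕ)
  simp only [Fin.succAbove, Fin.lt_def, Fin.val_castSucc, Fin.val_natAdd]
  split_ifs <;> simp <;> omega

theorem lastFace_δ_of_le {n : ℕ} (i : Fin (n + 4)) (hi : (i : ℕ) ≤ n) (y : X _⦋n + 3⦌) :
    lastFace n 2 (X.δ i y) = lastFace (n + 1) 2 y := by
  have h := congrArg (fun φ => X.map φ.op y) (lastVertices_comp_δ_of_le i hi)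
  rwa [op_comp, Functor.map_comp_apply] at h

theorem lastFace_δ_natAdd {n k : ℕ} (i : Fin (k + 2)) (y : X _⦋n + (k + 1)⦌) :
    lastFace n k (X.δ (n := n + k) (Fin.natAdd n i) y) = X.δ i (lastFace n (k + 1) y) := by
  have h := congrArg (fun φ => X.map φ.op y) (lastVertices_comp_δ_natAdd n i)
  rwa [op_comp, op_comp, Functor.map_comp_apply, Functor.map_comp_apply] at h

theorem δ_last_δ_castSucc {n : ℕ} (i : Fin (n + 2)) (z : X _⦋n + 2⦌) :
    X.δ (Fin.last (n + 1)) (X.δ i.castSucc z) = X.δ i (X.δ (Fin.last (n + 2)) z) :=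
  (congrArg (fun φ => φ z) (X.δ_comp_δ (Fin.le_last i))).symm

theorem frontFace_δ_castSucc {n : ℕ} (i : Fin (n + 2)) (y : X _⦋n + 3⦌) :
    frontFace (X.δ i.castSucc.castSucc y) = X.δ i (frontFace (n := n + 1) y) := by
  simp only [frontFace, δ_last_δ_castSucc]

theorem frontFace_δ_last {n : ℕ} (y : X _⦋n + 3⦌) :
    frontFace (X.δ (Fin.last (n + 3)) y) =
      X.δ (Fin.last (n + 1)) (frontFace (n := n + 1) y) := rfl

theorem frontFace_δ_castSucc_last {n : ℕ} (y : X _⦋n + 3⦌) :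
    frontFace (X.δ (Fin.last (n + 2)).castSucc y) =
      X.δ (Fin.last (n + 1)) (frontFace (n := n + 1) y) := by
  rw [frontFace, δ_last_δ_castSucc, frontFace]

/-- The cup product of a simplicial cochain with a cochain of degree two. -/
def cupTwo {n : ℕ} (f : X _⦋n⦌ → R) (u : X _⦋2⦌ → R) (z : X _⦋n + 2⦌) : R :=
  f (frontFace z) * u (lastFace n 2 z)

theorem apply_lastFace_of_faceD_eq_zero {n : ℕ} {u : X _⦋2⦌ → R} (hu : faceD u = 0)
    (y : X _⦋n + 3⦌) :
    u (lastFace (n + 1) 2 y) = u (lastFace n 2 (X.δ (Fin.last (n + 1)).castSucc.castSucc y)) -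
        u (lastFace n 2 (X.δ (Fin.last (n + 2)).castSucc y)) +
        u (lastFace n 2 (X.δ (Fin.last (n + 3)) y)) := by
  have hcocycle : ∑ i : Fin 4, (-1) ^ (i : ℕ) * u (X.δ i (lastFace n 3 y)) = 0 := congrFun hu _
  simp only [Fin.sum_univ_four, ← lastFace_δ_natAdd] at hcocycle
  rw [lastFace_δ_of_le (Fin.natAdd n (0 : Fin 4)) le_rfl,
    show Fin.natAdd n (1 : Fin 4) = (Fin.last (n + 1)).castSucc.castSucc from rfl,
    show Fin.natAdd n (2 : Fin 4) = (Fin.last (n + 2)).castSucc from rfl,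
    show Fin.natAdd n (3 : Fin 4) = Fin.last (n + 3) from rfl] at hcocycle
  norm_num at hcocycle
  linear_combination hcocycle

theorem faceD_cupTwo {n : ℕ} (f : X _⦋n⦌ → R) {u : X _⦋2⦌ → R} (hu : faceD u = 0) :
    faceD (cupTwo f u) = cupTwo (faceD f) u := by
  funext y
  have hlast (j : Fin (n + 1)) := lastFace_δ_of_le j.castSucc.castSucc.castSucc
    (Nat.le_of_lt_succ j.2) y
  simp only [faceD, cupTwo]
  rw [Fin.sum_univ_castSucc, Fin.sum_univ_castSucc, Fin.sum_univ_castSucc,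
    Fin.sum_univ_castSucc (n := n + 1), add_mul, Finset.sum_mul]
  simp only [frontFace_δ_castSucc, frontFace_δ_castSucc_last, frontFace_δ_last, hlast,
    Fin.val_castSucc, Fin.val_last]
  rw [apply_lastFace_of_faceD_eq_zero hu, add_assoc, add_assoc]
  congr 1
  · exact Finset.sum_congr rfl fun j _ => (mul_assoc _ _ _).symm
  · ring

/-- The powers of a cochain of degree two with respect to the simplicial cup product. -/
def cupTwoPower (u : X _⦋2⦌ → R) (m : ℕ) : X _⦋2 * m⦌ → R :=
  Nat.rec (motive := fun m => X _⦋2 * m⦌ → R) (fun _ => 1) (fun _ f => cupTwo f u) m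

theorem faceD_cupTwoPower {u : X _⦋2⦌ → R} (hu : faceD u = 0) (m : ℕ) :
    faceD (cupTwoPower u m) = 0 := by
  induction m with
  | zero =>
    funext y
    change ∑ i : Fin 2, (-1 : R) ^ (i : ℕ) * 1 = 0
    simp
  | succ m ih =>
    refine (faceD_cupTwo (cupTwoPower u m) hu).trans (funext fun y => ?_)
    rw [cupTwo, ih, Pi.zero_apply, zero_mul, Pi.zero_apply]

end SimplicialCup

section FundamentalClass

open scoped Simplicial

/-- The fundamental cocycle of `K(ℤ, 2)`, which evaluates a triangle at its nondegenerate
simplex. -/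
def fundamentalCocycle (z : deloopingTwo _⦋2⦌) : ℚ := (z.1 (𝟙 ⦋2⦌) : ℚ)

theorem faceD_fundamentalCocycle : faceD fundamentalCocycle = 0 := by
  funext z
  have hz := congrArg (Int.cast : ℤ → ℚ) (z.2.1 (𝟙 ⦋3⦌))
  push_cast at hz
  exact hz

theorem d_cupTwoPower_fundamentalCocycle (m : ℕ) :
    ((simplicialCochains deloopingTwo).d (2 * m) (2 * m + 1)).hom
      (cupTwoPower fundamentalCocycle m) = 0 :=
  (funext fun y => simplicialCochains_d_apply deloopingTwo (2 * m) _ y).trans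
    (faceD_cupTwoPower faceD_fundamentalCocycle m)

/-- The powers of the fundamental class of `K(ℤ, 2)`. -/
def fundamentalClassPower (m : ℕ) : (simplicialCochains deloopingTwo).homology (2 * m) :=
  ((simplicialCochains deloopingTwo).homologyπ (2 * m)).hom
    ((simplicialCochains deloopingTwo).cyclesMk (cupTwoPower fundamentalCocycle m) (2 * m + 1)
      (by simp) (d_cupTwoPower_fundamentalCocycle m))

variable {G : Type} [Group G] (c : TwoCocycle G)

theorem frontFace_classifyingSimplex {n : ℕ} (x : Fin (n + 2) → G) :
    frontFace (classifyingSimplex c x) = classifyingSimplex c (front x) := by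
  rw [frontFace, ← Fin.succ_last, ← Fin.succ_last, δ_succ_classifyingSimplex, contractNth_last,
    δ_succ_classifyingSimplex, contractNth_last]
  rfl

theorem edge_castSucc_succ {n : ℕ} (x : Fin n → G) (i : Fin n) :
    edge x i.castSucc i.succ = x i := by
  rw [edge, Fin.partialProd_succ, inv_mul_cancel_left]

theorem fundamentalCocycle_lastFace_classifyingSimplex {n : ℕ} (x : Fin (n + 2) → G) :
    fundamentalCocycle (lastFace n 2 (classifyingSimplex c x)) = weight c x :=
  congrArg₂ (fun a b => (c.toFun a b : ℚ)) (edge_castSucc_succ x (Fin.last n).castSucc)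
    (edge_castSucc_succ x (Fin.last (n + 1)))

theorem cupPower_succ (m : ℕ) (x : Fin (2 * m + 2) → G) :
    cupPower c (m + 1) x = cupPower c m (front x) * weight c x := rfl

theorem cupTwoPower_classifyingSimplex (m : ℕ) (x : Fin (2 * m) → G) :
    cupTwoPower fundamentalCocycle m (classifyingSimplex c x) = cupPower c m x := by
  induction m with
  | zero => rfl
  | succ m ih =>
    change cupTwo (cupTwoPower fundamentalCocycle m) _ (classifyingSimplex (n := 2 * m + 2) c x) = _
    rw [cupTwo, frontFace_classifyingSimplex, ih, fundamentalCocycle_lastFace_classifyingSimplex,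
      cupPower_succ]

theorem classifyingMap_fundamentalClassPower (m : ℕ) :
    (classifyingMap c (2 * m)).hom (fundamentalClassPower m) = cohomologyPower c m := by
  refine homologyMap_homologyπ_eq (classifyingCochains c) ?_
  refine Eq.trans ?_ (groupCohomology.iCocycles_mk _ _).symm
  refine (congrArg ((classifyingCochains c).f (2 * m)).hom
    ((simplicialCochains deloopingTwo).i_cyclesMk _ _ _ _)).trans ?_
  exact funext (cupTwoPower_classifyingSimplex c m)

end FundamentalClass

section Antisymmetrization

variable {G M : Type} [AddCommGroup M] [Module ℚ M] {n : ℕ}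

/-- The value of a function on the antisymmetrization of a tuple. -/
def altSum (a : Fin n → G) : ((Fin n → G) → M) →ₗ[ℚ] M :=
  ∑ σ : Equiv.Perm (Fin n), Equiv.Perm.sign σ • LinearMap.proj (a ∘ σ)

theorem altSum_apply (a : Fin n → G) (f : (Fin n → G) → M) :
    altSum a f = ∑ σ : Equiv.Perm (Fin n), Equiv.Perm.sign σ • f (a ∘ σ) := by
  simp [altSum]

theorem altSum_comp_perm (a : Fin n → G) (f : (Fin n → G) → M) (τ : Equiv.Perm (Fin n)) :
    altSum a (fun x => f (x ∘ τ)) = Equiv.Perm.sign τ • altSum a f := by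
  rw [altSum_apply, altSum_apply, Finset.smul_sum, ← Equiv.sum_comp (Equiv.mulRight τ⁻¹)]
  refine Finset.sum_congr rfl fun σ _ => ?_
  rw [Equiv.coe_mulRight, Equiv.Perm.sign_mul, Equiv.Perm.sign_inv, mul_comm, mul_smul,
    Function.comp_assoc, ← Equiv.Perm.coe_mul, inv_mul_cancel_right]

theorem altSum_eq_zero {f : (Fin n → G) → M} {τ : Equiv.Perm (Fin n)}
    (hτ : Equiv.Perm.sign τ = -1) (hf : ∀ x, f (x ∘ τ) = f x) (a : Fin n → G) :
    altSum a f = 0 := by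
  have h := altSum_comp_perm a f τ
  rw [funext hf, hτ, Units.neg_smul, one_smul] at h
  have : IsAddTorsionFree M := .of_module_rat M
  exact self_eq_neg.1 h

theorem altSum_tail (a : Fin (n + 1) → G) (f : (Fin n → G) → M) :
    altSum a (fun x => f (Fin.tail x)) = (-1 : ℚ) ^ n • altSum a (fun x => f (Fin.init x)) := by
  have hrotate (x : Fin (n + 1) → G) : Fin.init (x ∘ finRotate (n + 1)) = Fin.tail x := by
    funext i
    simp [Fin.init, Fin.tail]
  have h := altSum_comp_perm a (fun x => f (Fin.init x)) (finRotate (n + 1))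
  simp only [hrotate] at h
  rw [h, sign_finRotate, Units.smul_def, ← Int.cast_smul_eq_zsmul ℚ]
  push_cast
  rfl

variable {A : Type} [CommGroup A]

theorem contractNth_comp_swap (j : Fin n) (x : Fin (n + 1) → A) :
    Fin.contractNth j.castSucc (· * ·) (x ∘ Equiv.swap j.castSucc j.succ) =
      Fin.contractNth j.castSucc (· * ·) x := by
  funext k
  rcases lt_trichotomy (k : ℕ) (j : ℕ) with h | h | h
  · rw [Fin.contractNth_apply_of_lt _ _ _ _ (by simpa using h),
      Fin.contractNth_apply_of_lt _ _ _ _ (by simpa using h), Function.comp_apply,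
      Equiv.swap_apply_of_ne_of_ne]
    · simp only [ne_eq, Fin.ext_iff, Fin.val_castSucc]; omega
    · simp only [ne_eq, Fin.ext_iff, Fin.val_castSucc, Fin.val_succ]; omega
  · obtain rfl : k = j := Fin.ext h
    rw [Fin.contractNth_apply_of_eq _ _ _ _ (by simp),
      Fin.contractNth_apply_of_eq _ _ _ _ (by simp)]
    simp [mul_comm]
  · rw [Fin.contractNth_apply_of_gt _ _ _ _ (by simpa using h),
      Fin.contractNth_apply_of_gt _ _ _ _ (by simpa using h), Function.comp_apply,
      Equiv.swap_apply_of_ne_of_ne]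
    · simp only [ne_eq, Fin.ext_iff, Fin.val_castSucc, Fin.val_succ]; omega
    · simp only [ne_eq, Fin.ext_iff, Fin.val_succ]; omega

-- The inner faces are invariant under a transposition, as the group is abelian, and the two outer
-- faces differ by a cyclic rotation.
theorem altSum_barD (f : (Fin n → A) → M) (a : Fin (n + 1) → A) : altSum a (barD n f) = 0 := by
  have hcontract (j : Fin n) :
      altSum a (fun x => f (Fin.contractNth j.castSucc (· * ·) x)) = 0 :=
    altSum_eq_zero (Equiv.Perm.sign_swap (Fin.castSucc_lt_succ).ne)
      (fun x => by rw [contractNth_comp_swap]) a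
  have hbarD : barD n f = (fun x => f (Fin.tail x)) +
      ((∑ j : Fin n, (-1 : ℚ) ^ ((j : ℕ) + 1) •
        fun x => f (Fin.contractNth j.castSucc (· * ·) x)) +
        (-1 : ℚ) ^ (n + 1) • fun x => f (Fin.init x)) := by
    funext x
    simp only [barD, Fin.sum_univ_castSucc, contractNth_last, Pi.add_apply, Finset.sum_apply,
      Pi.smul_apply, Fin.val_castSucc, Fin.val_last]
    rfl
  simp only [hbarD, map_add, map_sum, map_smul, hcontract, altSum_tail, smul_zero,
    Finset.sum_const_zero, zero_add, ← add_smul]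
  rw [pow_succ, mul_neg_one, add_neg_cancel, zero_smul]

end Antisymmetrization

section Torus

variable {m : ℕ}

/-- The pairing of the indices `2i` and `2i + 1`, which are the images of `(i, 0)` and `(i, 1)`. -/
def pairIndex (m : ℕ) : Fin m × Fin 2 ≃ Fin (2 * m) :=
  finProdFinEquiv.trans (finCongr (Nat.mul_comm m 2))

theorem cupPower_eq_prod {G : Type} [Group G] (c : TwoCocycle G) (x : Fin (2 * m) → G) :
    cupPower c m x = ∏ i, (c.toFun (x (pairIndex m (i, 0))) (x (pairIndex m (i, 1))) : ℚ) := by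
  induction m with
  | zero => rfl
  | succ m ih =>
    rw [Fin.prod_univ_castSucc]
    have hlast (ε : Fin 2) : pairIndex (m + 1) (Fin.last m, ε) = Fin.natAdd (2 * m) ε :=
      Fin.ext (Nat.add_comm _ _)
    rw [hlast, hlast]
    exact (cupPower_succ c m x).trans (congrArg (· * weight c x) (ih (front x)))

variable {ι : Type}

theorem sign_eq_one_of_forall_apply_eq [Fintype ι] [DecidableEq ι] {σ : Equiv.Perm (ι × Fin 2)}
    {t : ι → ι} (hσ : ∀ i ε, σ (i, ε) = (t i, ε)) : Equiv.Perm.sign σ = 1 := by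
  have ht : Function.Injective t := fun i j hij => by
    have h : σ (i, 0) = σ (j, 0) := by rw [hσ, hσ, hij]
    exact congrArg Prod.fst (σ.injective h)
  have hprod : σ = Equiv.prodCongrLeft fun _ =>
      Equiv.ofBijective t (Finite.injective_iff_bijective.1 ht) := Equiv.ext fun p => hσ p.1 p.2
  rw [hprod, Equiv.Perm.sign_prodCongrLeft, Fin.prod_univ_two, Int.units_mul_self]

/-- The cocycle `∑ xᵢ₀ yᵢ₁` of a free abelian group of even rank. Its powers are nonzero in
cohomology. -/
def torusCocycle (ι : Type) [Fintype ι] : TwoCocycle (Multiplicative (ι × Fin 2 → ℤ)) where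
  toFun x y := ∑ i, x.toAdd (i, 0) * y.toAdd (i, 1)
  cocycle x y z := by
    simp only [toAdd_mul, Pi.add_apply, add_mul, mul_add, Finset.sum_add_distrib]
    ring
  one_left x := by simp
  one_right x := by simp

/-- The standard generators of a free abelian group of even rank. -/
def torusGenerator [DecidableEq ι] (p : ι × Fin 2) : Multiplicative (ι × Fin 2 → ℤ) :=
  Multiplicative.ofAdd (Pi.single p 1)

theorem torusCocycle_torusGenerator [Fintype ι] [DecidableEq ι] (p q : ι × Fin 2) :
    (torusCocycle ι).toFun (torusGenerator p) (torusGenerator q) =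
      if p.2 = 0 ∧ q = (p.1, 1) then 1 else 0 := by
  obtain ⟨i, ε⟩ := p
  obtain ⟨j, δ⟩ := q
  simp only [torusCocycle, torusGenerator, toAdd_ofAdd, Pi.single_apply, Prod.mk.injEq, mul_ite,
    mul_one, mul_zero, ← ite_and]
  rw [Finset.sum_eq_single i] <;> grind

theorem sign_smul_cupPower_torusCocycle_nonneg (σ : Equiv.Perm (Fin (2 * m))) :
    0 ≤ Equiv.Perm.sign σ • cupPower (torusCocycle (Fin m)) m
      ((torusGenerator ∘ (pairIndex m).symm) ∘ σ) := by
  rw [cupPower_eq_prod]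
  set τ := (pairIndex m).symm.permCongr σ
  have hτ (p) : (pairIndex m).symm (σ (pairIndex m p)) = τ p := rfl
  simp only [Function.comp_apply, hτ, torusCocycle_torusGenerator]
  by_cases hpair : ∀ i, (τ (i, 0)).2 = 0 ∧ τ (i, 1) = ((τ (i, 0)).1, 1)
  · have hsign : Equiv.Perm.sign τ = 1 :=
      sign_eq_one_of_forall_apply_eq fun i =>
        Fin.forall_fin_two.2 ⟨Prod.ext rfl (hpair i).1, (hpair i).2⟩
    rw [Equiv.Perm.sign_permCongr] at hsign
    rw [hsign, one_smul]
    positivity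
  · obtain ⟨i, hi⟩ := not_forall.1 hpair
    rw [Finset.prod_eq_zero (Finset.mem_univ i) (by rw [if_neg hi, Int.cast_zero]), smul_zero]

theorem altSum_torusGenerator_cupPower_pos (m : ℕ) :
    0 < altSum (torusGenerator ∘ (pairIndex m).symm) (cupPower (torusCocycle (Fin m)) m) := by
  rw [altSum_apply]
  refine Finset.sum_pos' (fun σ _ => sign_smul_cupPower_torusCocycle_nonneg σ)
    ⟨1, Finset.mem_univ _, ?_⟩
  simp [cupPower_eq_prod, torusCocycle_torusGenerator]

theorem cohomologyPower_torusCocycle_ne_zero (m : ℕ) :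
    cohomologyPower (torusCocycle (Fin (m + 1))) (m + 1) ≠ 0 := by
  rw [Ne, cohomologyPower_succ_eq_zero_iff]
  rintro ⟨f, hf⟩
  have h := altSum_torusGenerator_cupPower_pos (m + 1)
  rw [← hf] at h
  exact h.ne' (altSum_barD f _)

theorem fundamentalClassPower_succ_ne_zero (m : ℕ) : fundamentalClassPower (m + 1) ≠ 0 := by
  intro h
  apply cohomologyPower_torusCocycle_ne_zero m
  rw [← classifyingMap_fundamentalClassPower, h, map_zero]

theorem not_injective_classifyingMap {G : Type} [Group G] (c : TwoCocycle G)
    (h : cohomologyPower c (m + 1) = 0) :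
    ¬ Function.Injective (classifyingMap c (2 * (m + 1))) := by
  intro hinj
  refine fundamentalClassPower_succ_ne_zero m (hinj ?_)
  exact ((classifyingMap_fundamentalClassPower c (m + 1)).trans h).trans (map_zero _).symm

end Torus

end CentralBurghelea

end

theorem mainTheorem8_general (Γ : Type) [Group Γ] (hCBP : CentralBurghelea.CBP Γ)
    (hcd : CentralBurghelea.HasFiniteRationalCD Γ) :
    CentralBurghelea.IKP Γ ∧
      ∀ g : CentralBurghelea.CentralElement Γ, ∃ m : ℕ,
        CentralBurghelea.cohomologyPower g.eulerCocycle m = 0 := by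
  have hnilpotent (g : CentralBurghelea.CentralElement Γ) :
      ∃ m, CentralBurghelea.cohomologyPower g.eulerCocycle (m + 1) = 0 :=
    g.exists_cohomologyPower_succ_eq_zero (hCBP g) hcd
  refine ⟨⟨hcd, fun g => ?_⟩, fun g => ?_⟩
  · obtain ⟨m, hm⟩ := hnilpotent g
    exact ⟨2 * (m + 1), CentralBurghelea.not_injective_classifyingMap g.eulerCocycle hm⟩
  · obtain ⟨m, hm⟩ := hnilpotent g
    exact ⟨m + 1, hm⟩

theorem mainTheorem8 (Γ : Type) [Group Γ] (hCBP : CentralBurghelea.CBP Γ)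
    (hcd : CentralBurghelea.HasFiniteRationalCD Γ)
    (hft : CentralBurghelea.HasFiniteTypeRationalHomology Γ) :
    CentralBurghelea.IKP Γ ∧
      ∀ g : CentralBurghelea.CentralElement Γ, ∃ m : ℕ,
        CentralBurghelea.cohomologyPower g.eulerCocycle m = 0 :=
  mainTheorem8_general Γ hCBP hcd
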